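/- \textbf{Setting.} Fix one side of the order book. Let $Q$ be the queue at the best quote of that side: a non-explosive birth--death process on $\{0,1,2,\dots\}$ started at $Q(0)\ge 1$, with birth rate $\lambda_k\ge 0$ in state $k\ge 0$ and death rate $\mu_k+\phi_k$ in state $k\ge1$ ($\mu_k,\phi_k\ge 0$; market orders and cancellations). Let $\sigma=\inf\{t\ge 0: Q(t)=0\}$, and assume $\sigma<\infty$ almost surely. No orders are posted inside the spread, so the best quote moves to the next deeper level at time $\tau_{\rm quote}=\sigma$. At the deeper level there are initially $q_0\ge 1$ orders, the last being the order of interest. Let $\tilde W$ be the cancellation-only pure-death process started at $q_0$, independent of $Q$, which jumps from $k$ to $k-1$ at rate $\varphi_k$, where $\varphi_k>0$ for $1\le k\le q_0$. The order of interest is never cancelled, so the number of the initial orders still outstanding at time $t$ is $W(t)=\max(\tilde W(t),1)$. Let $\epsilon_{q_0,m}$ be the first time $\tilde W$ is in state $m$, and put $\hat f(s)=\mathbb E[e^{-s\sigma}]$ and $\hat h_{q_0,m}(s)=\mathbb E[e^{-s\epsilon_{q_0,m}}]$. For a function $H$ and $c>0$, the inverse (two-sided) Laplace transform of $H$ at $t=0$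 along $\operatorname{Re}s=c$ is $\lim_{R\to\infty}\frac1{2\pi i}\int_{c-iR}^{c+iR}H(s)\,ds$. \textbf{Proposition.} (a) For $0\le m\le q_0$, $\epsilon_{q_0,m}<\infty$ almost surely, and for every $s\in\mathbb C$ with $\operatorname{Re}s>-\varphi_k$ for all $m<k\le q_0$, $e^{-s\epsilon_{q_0,m}}$ is integrable and $$\hat h_{q_0,m}(s)=\prod_{k=m+1}^{q_0}\frac{\varphi_k}{\varphi_k+s}.$$ (b) If $q_0\ge 2$, then $\mathbb P[W(\tau_{\rm quote})=q_0]=\mathbb P[\sigma<\epsilon_{q_0,q_0-1}]$, and for every $c\in(0,\varphi_{q_0})$ this is the inverse Laplace transform at $0$, along $\operatorname{Re}s=c$, of $$\frac1s\,\hat f(s)\,\hat h_{q_0,q_0-1}(-s).$$ (c) If $1<m<q_0$, then $\mathbb P[W(\tau_{\rm quote})=m]=\mathbb P[\epsilon_{q_0,m}<\sigma]-\mathbb P[\epsilon_{q_0,m-1}<\sigma]$, and for every $c>0$ with $\mathbb E[e^{c\sigma}]<\infty$ this is the inverse Laplace transform at $0$, along $\operatorname{Re}s=c$, of $$\frac1s\,\hat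 f(-s)\bigl(\hat h_{q_0,m}(s)-\hat h_{q_0,m-1}(s)\bigr).$$ (d) $\mathbb P[W(\tau_{\rm quote})=1]=\mathbb P[\epsilon_{q_0,1}<\sigma]$, and for every $c>0$ with $\mathbb E[e^{c\sigma}]<\infty$ this is the inverse Laplace transform at $0$, along $\operatorname{Re}s=c$, of $$\frac1s\,\hat f(-s)\,\hat h_{q_0,1}(s).$$ -/

import Mathlib

open MeasureTheory ProbabilityTheory Filter Topology
open scoped NNReal ENNReal

noncomputable section

namespace LimitOrderBook

/-- Total jump rate out of state `x` of a birth-death process on the natural numbers with birth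
rates `b` and death rates `d`; no death is possible in state `0`. -/
def totalRate (b d : ℕ → ℝ) (x : ℕ) : ℝ :=
  b x + if x = 0 then 0 else d x

/-- Transition probabilities of the embedded jump chain of a birth-death process. A state with total
rate `0` is absorbing. -/
def jumpProb (b d : ℕ → ℝ) (x y : ℕ) : ℝ :=
  if totalRate b d x = 0 then (if y = x then 1 else 0)
  else if y = x + 1 then b x / totalRate b d x
  else if y + 1 = x then d x / totalRate b d x
  else 0

/-- `X` is a (non-explosive) birth-death process, started at `x₀`, with birth rate `b k` and death
rate `d k` in state `k`, in the jump chain / holding time description of a continuous-time Markov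
chain: `Y` is the embedded jump chain and `T n` the holding time before the `n + 1`-st jump (infinite
in an absorbing state). The chain `Y` starts at `x₀` and moves with probabilities `jumpProb`; given
`Y`, the holding times are independent, and `T n` is exponential with rate `totalRate b d (Y n)`.
The path is `Y n` between the `n`-th and the `n + 1`-st jump times, and these intervals cover all
of `[0, ∞)`. -/
def IsBirthDeath {Ω : Type*} [MeasurableSpace Ω] (P : Measure Ω) (b d : ℕ → ℝ) (x₀ : ℕ)
    (X : ℝ≥0 → Ω → ℕ) : Prop :=
  (∀ t, Measurable (X t)) ∧
  ∃ (Y : ℕ → Ω → ℕ) (T : ℕ → Ω → ℝ≥0∞),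
    (∀ n, Measurable (Y n)) ∧ (∀ n, Measurable (T n)) ∧
    (∀ (n : ℕ) (y : ℕ → ℕ) (t : ℕ → ℝ≥0),
      P {ω | (∀ k ≤ n, Y k ω = y k) ∧ ∀ k < n, (t k : ℝ≥0∞) < T k ω} =
        if y 0 = x₀ then
          ENNReal.ofReal (∏ k ∈ Finset.range n,
            jumpProb b d (y k) (y (k + 1)) * Real.exp (-(totalRate b d (y k) * t k)))
        else 0) ∧
    (∀ᵐ ω ∂P, ∀ t : ℝ≥0, ∃ n : ℕ,
      (∑ k ∈ Finset.range n, T k ω) ≤ t ∧ (t : ℝ≥0∞) < ∑ k ∈ Finset.range (n + 1), T k ω ∧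
      X t ω = Y n ω)

/-- A pure-death process with death rate `d k` in state `k`: no births. -/
def IsPureDeath {Ω : Type*} [MeasurableSpace Ω] (P : Measure Ω) (d : ℕ → ℝ) (x₀ : ℕ)
    (X : ℝ≥0 → Ω → ℕ) : Prop :=
  IsBirthDeath P (fun _ => 0) d x₀ X

/-- First time at which the process `X` is in state `m` (`∞` if this never happens). -/
def firstPassage {Ω : Type*} (X : ℝ≥0 → Ω → ℕ) (m : ℕ) (ω : Ω) : ℝ≥0∞ :=
  ⨅ (t : ℝ≥0) (_ : X t ω = m), (t : ℝ≥0∞)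

/-- Laplace transform `s ↦ E[exp (-s τ)]` of (the law of) a random time `τ`, where the integrand is
`0` on `{τ = ∞}`. If `τ` has a density, this is the Laplace transform of the density. -/
def laplace {Ω : Type*} [MeasurableSpace Ω] (P : Measure Ω) (τ : Ω → ℝ≥0∞) (s : ℂ) : ℂ :=
  ∫ ω in {ω | τ ω ≠ ∞}, Complex.exp (-s * ((τ ω).toReal : ℂ)) ∂P

/-- `v` is the value at `t` of the inverse (two-sided) Laplace transform of `H`, computed along the
line `Re s = c`, that is, the limit as `R → ∞` of the Bromwich integral
`(2 π i)⁻¹ ∫_{c - iR}^{c + iR} exp (s t) H(s) ds`. -/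
def IsInverseLaplaceAt (H : ℂ → ℂ) (c t v : ℝ) : Prop :=
  Tendsto
    (fun R : ℝ => (1 / (2 * Real.pi) : ℂ) *
      ∫ y in (-R)..R, Complex.exp ((c + y * Complex.I) * t) * H (c + y * Complex.I))
    atTop (𝓝 (v : ℂ))

/-- The time at which the best quote first moves to the deeper level: no orders are posted inside
the spread, so this is the first time at which the queue `Q` at the best quote is empty. -/
def quoteTime {Ω : Type*} (Q : ℝ≥0 → Ω → ℕ) : Ω → ℝ≥0∞ :=
  firstPassage Q 0

/-- Number of orders at the deeper level that were present at time `0` and are still outstanding.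
The cancellations follow the pure-death process `Wt`, except that the last of these orders, the one
of interest, is never cancelled. -/
def remaining {Ω : Type*} (Wt : ℝ≥0 → Ω → ℕ) (t : ℝ≥0) (ω : Ω) : ℕ :=
  max (Wt t ω) 1

/-- Probability that exactly `m` of the orders initially at the deeper level are still outstanding
when the best quote moves to that level. -/
def remainingProb {Ω : Type*} [MeasurableSpace Ω] (P : Measure Ω) (Q Wt : ℝ≥0 → Ω → ℕ) (m : ℕ) :
    ℝ :=
  P.real {ω | quoteTime Q ω ≠ ∞ ∧ remaining Wt (quoteTime Q ω).toNNReal ω = m}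

end LimitOrderBook

end

/-!
The passage time `ε` of the pure-death process from `q` to `m` is the sum of the independent
exponential times spent in the states `m + 1, …, q`. Its Laplace transform is therefore a product,
and its law has no atoms unless `m = q`, so that `ε` almost surely differs from the independent time
`σ > 0` at which the best quote moves.

For `Z = σ - ε`, the transform `E[exp (s Z)]` factorizes, and integrating `exp (s Z) / s` along
`Re s = c` before taking the expectation turns the Bromwich integral into `E[1_{Z > 0}]`, by
Perron's formula: the Bromwich integral of `exp (s z) / s` is the Heaviside function of `z ≠ 0`. The
passage to the limit under the expectation rests on a bound of the truncated integrals by a multiple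
of `exp (c z)`, uniform in `z` and in the truncation. It comes from splitting the range of
integration at `|Im s| = 1 / |z|`, with `|sin x| ≤ |x|` below and an integration by parts above.

The same integration by parts reduces Perron's formula to the absolutely convergent integral of
`exp (s z) / s ^ 2`, which is an instance of the Fourier inversion theorem.
-/

namespace LimitOrderBook

section Bromwich

open scoped Real ComplexConjugate FourierTransform
open Complex (I)

/-- The oscillating factor `exp (i y z) / (c + i y) ^ n` of the Bromwich integrand
`exp (s z) / s ^ n` on the line `s = c + i y`. -/
noncomputable def oscKernel (c z : ℝ) (n : ℕ) (y : ℝ) : ℂ :=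
  Complex.exp (↑(y * z) * I) / (c + y * I) ^ n

lemma add_mul_I_ne_zero {c : ℝ} (hc : c ≠ 0) (y : ℝ) : (c + y * I : ℂ) ≠ 0 := fun h =>
  hc (by simpa using congrArg Complex.re h)

lemma continuous_oscKernel {c : ℝ} (hc : c ≠ 0) (z : ℝ) (n : ℕ) : Continuous (oscKernel c z n) :=
  Continuous.div (by fun_prop) (by fun_prop) fun y => pow_ne_zero _ (add_mul_I_ne_zero hc y)

lemma norm_oscKernel (c z : ℝ) (n : ℕ) (y : ℝ) :
    ‖oscKernel c z n y‖ = (‖(c + y * I : ℂ)‖ ^ n)⁻¹ := by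
  rw [oscKernel, norm_div, norm_pow, Complex.norm_exp_ofReal_mul_I, one_div]

lemma norm_oscKernel_le (c z : ℝ) (n : ℕ) {y : ℝ} (hy : y ≠ 0) :
    ‖oscKernel c z n y‖ ≤ (|y| ^ n)⁻¹ := by
  have : 0 < |y| := abs_pos.2 hy
  rw [norm_oscKernel]
  gcongr
  simpa using Complex.abs_im_le_norm (c + y * I)

lemma oscKernel_neg (c z : ℝ) (n : ℕ) (y : ℝ) :
    oscKernel c z n (-y) = conj (oscKernel c z n y) := by
  simp only [oscKernel, map_div₀, map_pow, map_add, map_mul, Complex.conj_ofReal, Complex.conj_I,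
    ← Complex.exp_conj]
  push_cast
  ring_nf

lemma integral_oscKernel_eq_by_parts {c z : ℝ} (hc : c ≠ 0) (hz : z ≠ 0) (a b : ℝ) :
    ∫ y in a..b, oscKernel c z 1 y =
      (oscKernel c z 1 b - oscKernel c z 1 a) / (z * I) +
        1 / z * ∫ y in a..b, oscKernel c z 2 y := by
  have hz' : (z : ℂ) ≠ 0 := mod_cast hz
  have hderiv : ∀ y ∈ Set.uIcc a b, HasDerivAt (fun y : ℝ => oscKernel c z 1 y / (z * I))
      (oscKernel c z 1 y - 1 / z * oscKernel c z 2 y) y := by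
    intro y _
    have hne := add_mul_I_ne_zero hc y
    have hid : HasDerivAt (fun y : ℝ => (y : ℂ)) 1 y := Complex.ofRealCLM.hasDerivAt
    have hnum := ((hid.mul_const (z : ℂ)).mul_const I).cexp
    have hden := ((hid.mul_const I).const_add (c : ℂ)).pow 1
    simp only [oscKernel, Complex.ofReal_mul]
    refine ((hnum.div hden (pow_ne_zero 1 hne)).div_const (z * I)).congr_deriv ?_
    simp only [Pi.pow_apply]
    field_simp
    ring
  have hint₁ := (continuous_oscKernel hc z 1).intervalIntegrable (μ := volume) a b
  have hint₂ := ((continuous_oscKernel hc z 2).intervalIntegrable (μ := volume) a b).const_mul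
    (1 / (z : ℂ))
  rw [← intervalIntegral.integral_const_mul, sub_div,
    ← intervalIntegral.integral_eq_sub_of_hasDerivAt hderiv (hint₁.sub hint₂),
    intervalIntegral.integral_sub hint₁ hint₂, sub_add_cancel]

lemma norm_integral_oscKernel_two_le (c z : ℝ) {a b : ℝ} (ha : 0 < a) (hab : a ≤ b) :
    ‖∫ y in a..b, oscKernel c z 2 y‖ ≤ a⁻¹ - b⁻¹ := by
  have hpos : ∀ y ∈ Set.uIcc a b, 0 < y := fun y hy =>
    ha.trans_le (Set.uIcc_of_le hab ▸ hy : y ∈ Set.Icc a b).1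
  have h0 : (0 : ℝ) ∉ Set.uIcc a b := fun h => (hpos 0 h).false
  calc ‖∫ y in a..b, oscKernel c z 2 y‖ ≤ ∫ y in a..b, y ^ (-2 : ℤ) := by
        refine intervalIntegral.norm_integral_le_of_norm_le hab (ae_of_all _ fun y hy => ?_)
          (intervalIntegral.intervalIntegrable_zpow (Or.inr h0))
        have := norm_oscKernel_le c z 2 (ha.trans hy.1).ne'
        rwa [sq_abs] at this
    _ = a⁻¹ - b⁻¹ := by
        rw [integral_zpow (Or.inr ⟨by norm_num, h0⟩)]
        norm_num
        ring

lemma norm_integral_oscKernel_tail_le {c z : ℝ} (hc : c ≠ 0) (hz : z ≠ 0) {a b : ℝ} (ha : 0 < a)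
    (hab : a ≤ b) : ‖∫ y in a..b, oscKernel c z 1 y‖ ≤ 2 / (a * |z|) := by
  have : 0 < |z| := abs_pos.2 hz
  have hb : 0 < b := ha.trans_le hab
  have hbound : ∀ {y : ℝ}, 0 < y → ‖oscKernel c z 1 y‖ ≤ y⁻¹ := fun {y} hy => by
    simpa [abs_of_pos hy] using norm_oscKernel_le c z 1 hy.ne'
  rw [integral_oscKernel_eq_by_parts hc hz]
  calc _ ≤ (‖oscKernel c z 1 b‖ + ‖oscKernel c z 1 a‖) / |z| +
        1 / |z| * ‖∫ y in a..b, oscKernel c z 2 y‖ := by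
        refine (norm_add_le _ _).trans ?_
        simp only [norm_div, norm_mul, Complex.norm_I, Complex.norm_real, Real.norm_eq_abs,
          mul_one, norm_one]
        gcongr
        exact norm_sub_le _ _
    _ ≤ (b⁻¹ + a⁻¹) / |z| + 1 / |z| * (a⁻¹ - b⁻¹) := by
        gcongr
        exacts [hbound hb, hbound ha, norm_integral_oscKernel_two_le c z ha hab]
    _ = 2 / (a * |z|) := by field_simp; ring

lemma integral_oscKernel_symm {c : ℝ} (hc : c ≠ 0) (z : ℝ) (n : ℕ) (R : ℝ) :
    ∫ y in (-R)..R, oscKernel c z n y = ↑(2 * ∫ y in 0..R, (oscKernel c z n y).re) := by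
  have hint := fun a b => (continuous_oscKernel hc z n).intervalIntegrable (μ := volume) a b
  have hneg : ∫ y in (-R)..0, oscKernel c z n y = conj (∫ y in 0..R, oscKernel c z n y) := by
    rw [← intervalIntegral.intervalIntegral_conj]
    simp only [← oscKernel_neg, intervalIntegral.integral_comp_neg, neg_zero]
  have hre : ∫ y in 0..R, (oscKernel c z n y).re = (∫ y in 0..R, oscKernel c z n y).re :=
    intervalIntegral.intervalIntegral_re (hint 0 R)
  rw [← intervalIntegral.integral_add_adjacent_intervals (hint (-R) 0) (hint 0 R), hneg, add_comm,
    Complex.add_conj, hre]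

lemma abs_re_oscKernel_le {c : ℝ} (hc : 0 < c) (z y : ℝ) :
    |(oscKernel c z 1 y).re| ≤ c / (c ^ 2 + y ^ 2) + |z| := by
  have hden : 0 < c ^ 2 + y ^ 2 := by positivity
  have hre : (oscKernel c z 1 y).re =
      (c * Real.cos (y * z) + y * Real.sin (y * z)) / (c ^ 2 + y ^ 2) := by
    rw [oscKernel, pow_one, Complex.div_re, Complex.normSq_add_mul_I, Complex.exp_ofReal_mul_I_re,
      Complex.exp_ofReal_mul_I_im]
    simp
    ring
  have hcos : |c * Real.cos (y * z)| ≤ c := by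
    rw [abs_mul, abs_of_pos hc]
    exact mul_le_of_le_one_right hc.le (Real.abs_cos_le_one _)
  have hsin : |y * Real.sin (y * z)| ≤ |z| * (c ^ 2 + y ^ 2) := calc
    |y * Real.sin (y * z)| ≤ |y| * |y * z| := by
        rw [abs_mul]
        exact mul_le_mul_of_nonneg_left Real.abs_sin_le_abs (abs_nonneg y)
    _ = |z| * y ^ 2 := by rw [abs_mul, ← mul_assoc, abs_mul_abs_self]; ring
    _ ≤ |z| * (c ^ 2 + y ^ 2) := by
        gcongr
        exact le_add_of_nonneg_left (sq_nonneg c)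
  rw [hre, abs_div, abs_of_pos hden, div_le_iff₀ hden, add_mul, div_mul_cancel₀ _ hden.ne']
  exact (abs_add_le _ _).trans (add_le_add hcos hsin)

lemma abs_integral_re_oscKernel_le {c : ℝ} (hc : 0 < c) (z : ℝ) {a : ℝ} (ha : 0 ≤ a) :
    |∫ y in 0..a, (oscKernel c z 1 y).re| ≤ π / 2 + a * |z| := by
  have hint : IntervalIntegrable (fun y : ℝ => c / (c ^ 2 + y ^ 2)) volume 0 a :=
    (Continuous.div (by fun_prop) (by fun_prop) fun y => by positivity).intervalIntegrable _ _
  calc |∫ y in 0..a, (oscKernel c z 1 y).re|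
      ≤ ∫ y in 0..a, (c / (c ^ 2 + y ^ 2) + |z|) :=
        intervalIntegral.norm_integral_le_of_norm_le (f := fun y => (oscKernel c z 1 y).re) ha
          (ae_of_all _ fun y _ => abs_re_oscKernel_le hc z y) (hint.add intervalIntegrable_const)
    _ = Real.arctan (a / c) + a * |z| := by
        rw [intervalIntegral.integral_add hint intervalIntegrable_const, integral_div_sq_add_sq]
        simp
    _ ≤ π / 2 + a * |z| := by gcongr; exact (Real.arctan_lt_pi_div_two _).le

lemma abs_integral_re_oscKernel_le_const {c : ℝ} (hc : 0 < c) (z : ℝ) {R : ℝ} (hR : 0 ≤ R) :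
    |∫ y in 0..R, (oscKernel c z 1 y).re| ≤ π / 2 + 3 := by
  by_cases hRz : R * |z| ≤ 1
  · linarith [abs_integral_re_oscKernel_le hc z hR]
  have hz : z ≠ 0 := by rintro rfl; simp at hRz
  have hz' : 0 < |z| := abs_pos.2 hz
  have hle : |z|⁻¹ ≤ R := by rw [inv_le_iff_one_le_mul₀ hz']; linarith
  have hcont : Continuous fun y => (oscKernel c z 1 y).re :=
    Complex.continuous_re.comp (continuous_oscKernel hc.ne' z 1)
  have hcenter := abs_integral_re_oscKernel_le hc z (inv_pos.2 hz').le
  have htail : |∫ y in |z|⁻¹..R, (oscKernel c z 1 y).re| ≤ 2 := by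
    have hint := (continuous_oscKernel hc.ne' z 1).intervalIntegrable (μ := volume) |z|⁻¹ R
    have hre : ∫ y in |z|⁻¹..R, (oscKernel c z 1 y).re = (∫ y in |z|⁻¹..R, oscKernel c z 1 y).re :=
      intervalIntegral.intervalIntegral_re hint
    have hnorm := norm_integral_oscKernel_tail_le hc.ne' hz (inv_pos.2 hz') hle
    rw [inv_mul_cancel₀ hz'.ne', div_one] at hnorm
    exact hre ▸ (Complex.abs_re_le_norm _).trans hnorm
  rw [inv_mul_cancel₀ hz'.ne'] at hcenter
  rw [← intervalIntegral.integral_add_adjacent_intervals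
    (hcont.intervalIntegrable 0 |z|⁻¹) (hcont.intervalIntegrable _ R)]
  linarith [abs_add_le (∫ y in 0..|z|⁻¹, (oscKernel c z 1 y).re)
    (∫ y in |z|⁻¹..R, (oscKernel c z 1 y).re)]

lemma norm_integral_oscKernel_le {c : ℝ} (hc : 0 < c) (z : ℝ) {R : ℝ} (hR : 0 ≤ R) :
    ‖∫ y in (-R)..R, oscKernel c z 1 y‖ ≤ π + 6 := by
  rw [integral_oscKernel_symm hc.ne', Complex.norm_real, Real.norm_eq_abs, abs_mul, abs_two]
  linarith [abs_integral_re_oscKernel_le_const hc z hR]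

lemma integrable_oscKernel_two {c : ℝ} (hc : c ≠ 0) (z : ℝ) : Integrable (oscKernel c z 2) := by
  have h := (integrable_inv_one_add_sq.comp_mul_right' (inv_ne_zero hc)).const_mul (c ^ 2)⁻¹
  refine h.mono' (continuous_oscKernel hc z 2).aestronglyMeasurable
    (ae_of_all _ fun y => le_of_eq ?_)
  rw [norm_oscKernel, Complex.sq_norm, Complex.normSq_add_mul_I]
  field_simp

lemma norm_cexp_neg_mul_ofReal (s : ℂ) (t : ℝ) :
    ‖Complex.exp (-(s * t))‖ = Real.exp (-s.re * t) := by
  rw [Complex.norm_exp]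
  simp

lemma tendsto_pow_mul_cexp_neg_atTop {s : ℂ} (hs : 0 < s.re) (n : ℕ) :
    Tendsto (fun t : ℝ => (t : ℂ) ^ n * Complex.exp (-(s * t))) atTop (𝓝 0) := by
  rw [tendsto_zero_iff_norm_tendsto_zero]
  refine (tendsto_rpow_mul_exp_neg_mul_atTop_nhds_zero n s.re hs).congr' ?_
  filter_upwards [eventually_ge_atTop 0] with t ht
  rw [norm_mul, norm_cexp_neg_mul_ofReal, norm_pow, Complex.norm_real, Real.norm_of_nonneg ht,
    Real.rpow_natCast]

lemma integrableOn_mul_cexp_neg_Ioi {s : ℂ} (hs : 0 < s.re) :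
    IntegrableOn (fun t : ℝ => (t : ℂ) * Complex.exp (-(s * t))) (Set.Ioi 0) := by
  have hreal := integrableOn_rpow_mul_exp_neg_mul_rpow (s := 1) (p := 1) (by norm_num) one_pos hs
  refine Integrable.mono' hreal (by fun_prop) ?_
  filter_upwards [ae_restrict_mem measurableSet_Ioi] with t ht
  rw [norm_mul, norm_cexp_neg_mul_ofReal, Complex.norm_real, Real.norm_of_nonneg (le_of_lt ht),
    Real.rpow_one]

lemma integral_mul_cexp_neg_Ioi {s : ℂ} (hs : 0 < s.re) :
    ∫ t in Set.Ioi (0 : ℝ), (t : ℂ) * Complex.exp (-(s * t)) = 1 / s ^ 2 := by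
  have hs0 : s ≠ 0 := by rintro rfl; simp at hs
  have hderiv : ∀ t ∈ Set.Ici (0 : ℝ), HasDerivAt
      (fun t : ℝ => -((t / s + 1 / s ^ 2) * Complex.exp (-(s * t))))
      ((t : ℂ) * Complex.exp (-(s * t))) t := by
    intro t _
    have hid : HasDerivAt (fun t : ℝ => (t : ℂ)) 1 t := Complex.ofRealCLM.hasDerivAt
    refine (((hid.div_const s).add_const (1 / s ^ 2)).mul
      ((hid.const_mul s).neg.cexp)).neg.congr_deriv ?_
    simp only [Pi.neg_apply]
    field_simp
    ring
  have hlim : Tendsto (fun t : ℝ => -((t / s + 1 / s ^ 2) * Complex.exp (-(s * t)))) atTop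
      (𝓝 0) := by
    have h := ((tendsto_pow_mul_cexp_neg_atTop hs 1).const_mul (-(1 / s))).add
      ((tendsto_pow_mul_cexp_neg_atTop hs 0).const_mul (-(1 / s ^ 2)))
    simp only [mul_zero, add_zero] at h
    refine h.congr fun t => ?_
    ring
  rw [integral_Ioi_of_hasDerivAt_of_tendsto' hderiv (integrableOn_mul_cexp_neg_Ioi hs) hlim]
  simp

/-- The function `t ↦ t⁺ exp (-c t)`, whose Laplace transform at `s` is `1 / (s + c) ^ 2`. -/
noncomputable def dampedRamp (c t : ℝ) : ℂ := ↑(max t 0 * Real.exp (-(c * t)))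

lemma continuous_dampedRamp (c : ℝ) : Continuous (dampedRamp c) := by
  unfold dampedRamp
  fun_prop

lemma dampedRamp_of_pos (c : ℝ) {t : ℝ} (ht : 0 < t) :
    dampedRamp c t = t * Complex.exp (-(c * t)) := by
  simp [dampedRamp, max_eq_left ht.le]

lemma dampedRamp_of_nonpos (c : ℝ) {t : ℝ} (ht : t ≤ 0) : dampedRamp c t = 0 := by
  simp [dampedRamp, max_eq_right ht]

lemma integrable_dampedRamp {c : ℝ} (hc : 0 < c) : Integrable (dampedRamp c) := by
  have hsupp : Function.support (dampedRamp c) ⊆ Set.Ioi 0 := fun t ht =>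
    not_le.1 fun h => ht (dampedRamp_of_nonpos c h)
  rw [← integrableOn_iff_integrable_of_support_subset hsupp]
  exact (integrableOn_mul_cexp_neg_Ioi (s := c) hc).congr_fun
    (fun t ht => (dampedRamp_of_pos c ht).symm) measurableSet_Ioi

lemma fourier_dampedRamp {c : ℝ} (hc : 0 < c) (w : ℝ) :
    𝓕 (dampedRamp c) w = oscKernel c 0 2 (2 * π * w) := by
  have hre : 0 < ((c : ℂ) + (2 * π * w : ℝ) * I).re := by simpa using hc
  rw [oscKernel, mul_zero, Complex.ofReal_zero, zero_mul, Complex.exp_zero,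
    ← integral_mul_cexp_neg_Ioi hre, Real.fourier_real_eq_integral_exp_smul,
    ← setIntegral_eq_integral_of_forall_compl_eq_zero (s := Set.Ioi 0) fun t ht => by
      rw [dampedRamp_of_nonpos c (not_lt.1 ht), smul_zero]]
  refine setIntegral_congr_fun measurableSet_Ioi fun t ht => ?_
  simp only [dampedRamp_of_pos c ht, smul_eq_mul]
  push_cast
  rw [mul_left_comm, ← Complex.exp_add]
  ring_nf

lemma integral_oscKernel_two {c : ℝ} (hc : 0 < c) (z : ℝ) :
    ∫ y, oscKernel c z 2 y = 2 * π * dampedRamp c z := by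
  have hpi : (0 : ℝ) < 2 * π := by positivity
  have hfourier : 𝓕 (dampedRamp c) = fun w => oscKernel c 0 2 (2 * π * w) :=
    funext (fourier_dampedRamp hc)
  have hinv : 𝓕⁻ (𝓕 (dampedRamp c)) z = dampedRamp c z :=
    (integrable_dampedRamp hc).fourierInv_fourier_eq
      (hfourier ▸ (integrable_oscKernel_two hc.ne' 0).comp_mul_left' hpi.ne')
      (continuous_dampedRamp c).continuousAt
  have hscale : ∫ w, oscKernel c z 2 (2 * π * w) = dampedRamp c z := by
    rw [← hinv, Real.fourierInv_eq', hfourier]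
    refine integral_congr_ae (ae_of_all _ fun w => ?_)
    simp only [oscKernel, smul_eq_mul, mul_zero, Complex.ofReal_zero, zero_mul, Complex.exp_zero,
      mul_one_div]
    congr 3
    simp
    ring
  rw [Measure.integral_comp_mul_left, abs_of_pos (by positivity), Complex.real_smul] at hscale
  rw [← hscale]
  push_cast
  field_simp

/-- The Bromwich integral of `exp (s z) / s` along `Re s = c`, truncated to `|Im s| ≤ R`. -/
noncomputable def perronKernel (c R z : ℝ) : ℂ :=
  1 / (2 * π) * ∫ y in (-R)..R, Complex.exp ((c + y * I) * z) / (c + y * I)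

lemma perronKernel_eq (c R z : ℝ) :
    perronKernel c R z =
      1 / (2 * π) * (Real.exp (c * z) * ∫ y in (-R)..R, oscKernel c z 1 y) := by
  have hfactor : ∀ y : ℝ, Complex.exp ((c + y * I) * z) / (c + y * I) =
      Real.exp (c * z) * oscKernel c z 1 y := fun y => by
    rw [oscKernel, pow_one, ← mul_div_assoc, Complex.ofReal_exp, ← Complex.exp_add]
    push_cast
    ring_nf
  simp only [perronKernel, hfactor, intervalIntegral.integral_const_mul]

lemma norm_perronKernel_le {c : ℝ} (hc : 0 < c) {R : ℝ} (hR : 0 ≤ R) (z : ℝ) :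
    ‖perronKernel c R z‖ ≤ 2 * Real.exp (c * z) := by
  have hpi : ‖(1 / (2 * π) : ℂ)‖ = 1 / (2 * π) := by
    rw [show (1 / (2 * π) : ℂ) = ((1 / (2 * π) : ℝ) : ℂ) by push_cast; rfl, Complex.norm_real,
      Real.norm_of_nonneg (by positivity)]
  rw [perronKernel_eq, norm_mul, norm_mul, Complex.norm_real, Real.norm_of_nonneg (by positivity),
    hpi]
  calc _ ≤ 1 / (2 * π) * (Real.exp (c * z) * (π + 6)) := by
        gcongr
        exact norm_integral_oscKernel_le hc z hR
    _ = (π + 6) / (2 * π) * Real.exp (c * z) := by ring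
    _ ≤ 2 * Real.exp (c * z) := by
        gcongr
        rw [div_le_iff₀ (by positivity)]
        linarith [Real.two_le_pi]

lemma measurable_perronKernel (c R : ℝ) : Measurable (perronKernel c R) := by
  have h : StronglyMeasurable (Function.uncurry fun z y : ℝ =>
      Complex.exp ((c + y * I) * z) / (c + y * I)) :=
    Measurable.stronglyMeasurable (by simp only [Function.uncurry_def]; fun_prop)
  unfold perronKernel intervalIntegral
  exact (h.integral_prod_right.sub h.integral_prod_right).measurable.const_mul _

lemma tendsto_integral_oscKernel {c : ℝ} (hc : 0 < c) {z : ℝ} (hz : z ≠ 0) :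
    Tendsto (fun R => ∫ y in (-R)..R, oscKernel c z 1 y) atTop
      (𝓝 (1 / z * (2 * π * dampedRamp c z))) := by
  have hboundary : Tendsto (oscKernel c z 1) (Bornology.cobounded ℝ) (𝓝 0) := by
    refine squeeze_zero_norm' ?_ (tendsto_norm_cobounded_atTop (E := ℝ)).inv_tendsto_atTop
    filter_upwards [Bornology.eventually_ne_cobounded (0 : ℝ)] with y hy
    simpa using norm_oscKernel_le c z 1 hy
  have hsecond : Tendsto (fun R => ∫ y in (-R)..R, oscKernel c z 2 y) atTop
      (𝓝 (2 * π * dampedRamp c z)) := by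
    rw [← integral_oscKernel_two hc z]
    exact intervalIntegral_tendsto_integral (integrable_oscKernel_two hc.ne' z)
      tendsto_neg_atTop_atBot tendsto_id
  have hright := hboundary.mono_left IsOrderBornology.atTop_le_cobounded
  have hleft := hboundary.comp
    (tendsto_neg_atTop_atBot.mono_right IsOrderBornology.atBot_le_cobounded)
  simpa [Function.comp_def, integral_oscKernel_eq_by_parts hc.ne' hz] using
    ((hright.sub hleft).div_const (z * I)).add (hsecond.const_mul (1 / (z : ℂ)))

lemma tendsto_perronKernel {c : ℝ} (hc : 0 < c) {z : ℝ} (hz : z ≠ 0) :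
    Tendsto (fun R => perronKernel c R z) atTop (𝓝 (if 0 < z then 1 else 0)) := by
  simp only [perronKernel_eq]
  convert ((tendsto_integral_oscKernel hc hz).const_mul (Real.exp (c * z) : ℂ)).const_mul
    (1 / (2 * π) : ℂ) using 2
  have hpi : (π : ℂ) ≠ 0 := mod_cast Real.pi_ne_zero
  have hz' : (z : ℂ) ≠ 0 := mod_cast hz
  split_ifs with h
  · rw [dampedRamp_of_pos c h, Complex.exp_neg]
    push_cast
    field_simp
  · rw [dampedRamp_of_nonpos c (not_lt.1 h)]
    simp

end Bromwich

section ComplexMGF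

open scoped Real
open Complex (I)

variable {Ω : Type*} [MeasurableSpace Ω] {P : Measure Ω} {c t : ℝ} {Z : Ω → ℝ}

lemma integrable_uncurry_bromwich (hZ : AEMeasurable Z P) (hc : 0 < c)
    (hint : Integrable (fun ω => Real.exp (c * Z ω)) P) (a b : ℝ) :
    Integrable (Function.uncurry fun (y : ℝ) ω =>
        Complex.exp ((c + y * I) * ↑(t + Z ω)) / (c + y * I))
      ((volume.restrict (Set.uIoc a b)).prod P) := by
  have : IsFiniteMeasure (volume.restrict (Set.uIoc a b)) := ⟨by simp [Set.uIoc]⟩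
  have hdom : Integrable (fun p : ℝ × Ω => Real.exp (c * t) / c * Real.exp (c * Z p.2))
      ((volume.restrict (Set.uIoc a b)).prod P) :=
    Integrable.mul_prod (f := fun _ : ℝ => Real.exp (c * t) / c) (integrable_const _) hint
  have : AEMeasurable (fun p : ℝ × Ω => Z p.2) ((volume.restrict (Set.uIoc a b)).prod P) :=
    hZ.comp_snd
  refine hdom.mono' (AEMeasurable.aestronglyMeasurable ?_) (ae_of_all _ fun p => ?_)
  · simp only [Function.uncurry_def]
    fun_prop
  · have hre : ((c + p.1 * I) * ↑(t + Z p.2) : ℂ).re = c * t + c * Z p.2 := by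
      simp
      ring
    have hle : c ≤ ‖(c + p.1 * I : ℂ)‖ := by
      simpa [abs_of_pos hc] using Complex.abs_re_le_norm (c + p.1 * I : ℂ)
    rw [Function.uncurry_def, norm_div, Complex.norm_exp, hre, Real.exp_add, div_mul_eq_mul_div]
    gcongr

lemma bromwich_complexMGF_eq_integral_perronKernel [SFinite P] (hZ : AEMeasurable Z P)
    (hc : 0 < c) (hint : Integrable (fun ω => Real.exp (c * Z ω)) P) (R : ℝ) :
    (1 / (2 * π) : ℂ) * ∫ y in (-R)..R, Complex.exp ((c + y * I) * t) *
        (1 / (c + y * I) * complexMGF Z P (c + y * I)) =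
      ∫ ω, perronKernel c R (t + Z ω) ∂P := by
  have hfactor : ∀ y : ℝ, Complex.exp ((c + y * I) * t) *
      (1 / (c + y * I) * complexMGF Z P (c + y * I)) =
      ∫ ω, Complex.exp ((c + y * I) * ↑(t + Z ω)) / (c + y * I) ∂P := fun y => by
    rw [complexMGF, ← integral_const_mul, ← integral_const_mul]
    congr with ω
    rw [Complex.ofReal_add, mul_add, Complex.exp_add]
    ring
  simp only [hfactor, perronKernel]
  rw [integral_const_mul,
    intervalIntegral_integral_swap (integrable_uncurry_bromwich hZ hc hint (-R) R)]

theorem isInverseLaplaceAt_complexMGF [SFinite P] (hZ : AEMeasurable Z P)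
    (hne : ∀ᵐ ω ∂P, Z ω ≠ -t) (hc : 0 < c) (hint : Integrable (fun ω => Real.exp (c * Z ω)) P) :
    IsInverseLaplaceAt (fun s => 1 / s * complexMGF Z P s) c t (P.real {ω | 0 < t + Z ω}) := by
  have hprob : ((P.real {ω | 0 < t + Z ω} : ℝ) : ℂ) =
      ∫ ω, (if 0 < t + Z ω then (1 : ℂ) else 0) ∂P := by
    have hset : NullMeasurableSet {ω | 0 < t + Z ω} P :=
      nullMeasurableSet_lt aemeasurable_const (hZ.const_add t)
    have hindicator : (fun ω => if 0 < t + Z ω then (1 : ℂ) else 0) =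
        {ω | 0 < t + Z ω}.indicator fun _ => 1 := by
      ext ω
      simp [Set.indicator_apply]
    rw [hindicator, integral_indicator₀ hset]
    simp
  have hdom : Integrable (fun ω => 2 * Real.exp (c * (t + Z ω))) P := by
    simpa only [mul_add, Real.exp_add] using (hint.const_mul (Real.exp (c * t))).const_mul 2
  unfold IsInverseLaplaceAt
  simp only [bromwich_complexMGF_eq_integral_perronKernel hZ hc hint]
  rw [hprob]
  refine tendsto_integral_filter_of_dominated_convergence _ ?_ ?_ hdom ?_
  · exact Eventually.of_forall fun R =>
      ((measurable_perronKernel c R).comp_aemeasurable (hZ.const_add t)).aestronglyMeasurable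
  · filter_upwards [eventually_ge_atTop 0] with R hR
    exact ae_of_all _ fun ω => norm_perronKernel_le hc hR _
  · filter_upwards [hne] with ω hω
    exact tendsto_perronKernel hc fun h => hω (by linarith)

lemma integrable_cexp_mul (hZ : AEMeasurable Z P) {s : ℂ}
    (hint : Integrable (fun ω => Real.exp (s.re * Z ω)) P) :
    Integrable (fun ω => Complex.exp (s * Z ω)) P := by
  refine hint.mono' (AEMeasurable.aestronglyMeasurable (by fun_prop)) (ae_of_all _ fun ω => ?_)
  simp [Complex.norm_exp]

lemma continuous_complexMGF_add_mul_I (hZ : AEMeasurable Z P)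
    (hint : Integrable (fun ω => Real.exp (c * Z ω)) P) :
    Continuous fun y : ℝ => complexMGF Z P (c + y * I) := by
  refine continuous_of_dominated (fun y => AEMeasurable.aestronglyMeasurable (by fun_prop))
    (fun y => ae_of_all _ fun ω => ?_) hint (ae_of_all _ fun ω => by fun_prop)
  simp [Complex.norm_exp]

lemma complexMGF_add_of_indepFun {A B : Ω → ℝ} (hA : AEMeasurable A P) (hB : AEMeasurable B P)
    (hAB : IndepFun A B P) (s : ℂ) :
    complexMGF (A + B) P s = complexMGF A P s * complexMGF B P s := by
  have h := IndepFun.integral_fun_mul_eq_mul_integral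
    (hAB.comp (φ := fun x : ℝ => Complex.exp (s * x)) (ψ := fun x : ℝ => Complex.exp (s * x))
      (by fun_prop) (by fun_prop))
    (AEMeasurable.aestronglyMeasurable (by fun_prop))
    (AEMeasurable.aestronglyMeasurable (by fun_prop))
  simpa only [complexMGF, Function.comp_apply, ← Complex.exp_add, ← mul_add,
    ← Complex.ofReal_add, Pi.add_apply] using h

lemma complexMGF_sub_of_indepFun {A B : Ω → ℝ} (hA : AEMeasurable A P) (hB : AEMeasurable B P)
    (hAB : IndepFun A B P) (s : ℂ) :
    complexMGF (A - B) P s = complexMGF A P s * complexMGF B P (-s) := by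
  have hneg : complexMGF (-B) P s = complexMGF B P (-s) := by simp [complexMGF]
  rw [sub_eq_add_neg, ← hneg,
    complexMGF_add_of_indepFun hA hB.neg (hAB.comp measurable_id measurable_neg)]

lemma complexMGF_sum_of_iIndepFun {ι : Type*} {X : ι → Ω → ℝ} (hX : ∀ i, AEMeasurable (X i) P)
    (hind : iIndepFun X P) (F : Finset ι) (s : ℂ) :
    complexMGF (∑ i ∈ F, X i) P s = ∏ i ∈ F, complexMGF (X i) P s := by
  classical
  have := hind.isProbabilityMeasure
  induction F using Finset.induction_on with
  | empty => simp [complexMGF]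
  | insert i F hi ih =>
    rw [Finset.sum_insert hi, Finset.prod_insert hi, ← ih]
    exact complexMGF_add_of_indepFun (hX i) (F.aemeasurable_sum fun j _ => hX j)
      (hind.indepFun_finsetSum_of_notMem₀ hX hi).symm s

theorem isInverseLaplaceAt_prob_lt [IsFiniteMeasure P] {A B : Ω → ℝ} (hA : AEMeasurable A P)
    (hB : AEMeasurable B P) (hAB : IndepFun A B P) (hne : ∀ᵐ ω ∂P, A ω ≠ B ω) (hc : 0 < c)
    (hAint : Integrable (fun ω => Real.exp (c * A ω)) P)
    (hBint : Integrable (fun ω => Real.exp (-c * B ω)) P) :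
    IsInverseLaplaceAt (fun s => 1 / s * complexMGF A P s * complexMGF B P (-s)) c 0
      (P.real {ω | B ω < A ω}) := by
  have hint : Integrable (fun ω => Real.exp (c * (A - B) ω)) P := by
    rw [sub_eq_add_neg]
    exact (hAB.comp measurable_id measurable_neg).integrable_exp_mul_add hAint
      (by simpa using hBint)
  have hne' : ∀ᵐ ω ∂P, (A - B) ω ≠ -0 := hne.mono fun ω h => by simpa [sub_eq_zero] using h
  simpa [complexMGF_sub_of_indepFun hA hB hAB, mul_assoc] using
    isInverseLaplaceAt_complexMGF (hA.sub hB) hne' hc hint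

lemma IsInverseLaplaceAt.sub {H K : ℂ → ℂ} {v w : ℝ} (hH : IsInverseLaplaceAt H c t v)
    (hK : IsInverseLaplaceAt K c t w) (hHc : Continuous fun y : ℝ => H (c + y * I))
    (hKc : Continuous fun y : ℝ => K (c + y * I)) :
    IsInverseLaplaceAt (fun s => H s - K s) c t (v - w) := by
  have hexp : Continuous fun y : ℝ => Complex.exp ((c + y * I) * t) := by fun_prop
  have h := Tendsto.sub hH hK
  simp only [← mul_sub] at h
  simp only [IsInverseLaplaceAt, mul_sub, Complex.ofReal_sub]
  exact h.congr fun R => congrArg _ (intervalIntegral.integral_sub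
    ((hexp.mul hHc).intervalIntegrable _ _) ((hexp.mul hKc).intervalIntegrable _ _)).symm

end ComplexMGF

section RandomTimes

open Complex (I)

variable {Ω : Type*} [MeasurableSpace Ω] {P : Measure Ω} {c : ℝ} {σ τ : Ω → ℝ≥0∞}

lemma laplace_eq_complexMGF (hτ : ∀ᵐ ω ∂P, τ ω ≠ ∞) (s : ℂ) :
    laplace P τ s = complexMGF (fun ω => (τ ω).toReal) P (-s) := by
  rw [laplace, Measure.restrict_eq_self_of_ae_mem (s := {ω | τ ω ≠ ∞}) hτ, complexMGF]

lemma integrable_exp_neg_mul_toReal [IsFiniteMeasure P] (hτ : AEMeasurable τ P) (hc : 0 ≤ c) :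
    Integrable (fun ω => Real.exp (-c * (τ ω).toReal)) P := by
  refine .of_bound (AEMeasurable.aestronglyMeasurable (by fun_prop)) 1 (ae_of_all _ fun ω => ?_)
  rw [Real.norm_eq_abs, Real.abs_exp, Real.exp_le_one_iff, neg_mul, neg_nonpos]
  exact mul_nonneg hc ENNReal.toReal_nonneg

lemma continuous_laplace_add_mul_I (hτm : AEMeasurable τ P) (hτ : ∀ᵐ ω ∂P, τ ω ≠ ∞)
    (hint : Integrable (fun ω => Real.exp (-c * (τ ω).toReal)) P) :
    Continuous fun y : ℝ => laplace P τ (c + y * I) := by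
  simpa only [laplace_eq_complexMGF hτ, Function.comp_def, Complex.ofReal_neg, neg_mul, ← neg_add]
    using (continuous_complexMGF_add_mul_I hτm.ennreal_toReal hint).comp continuous_neg

lemma continuous_laplace_neg_add_mul_I (hτm : AEMeasurable τ P) (hτ : ∀ᵐ ω ∂P, τ ω ≠ ∞)
    (hint : Integrable (fun ω => Real.exp (c * (τ ω).toReal)) P) :
    Continuous fun y : ℝ => laplace P τ (-(c + y * I)) := by
  simpa only [laplace_eq_complexMGF hτ, neg_neg]
    using continuous_complexMGF_add_mul_I hτm.ennreal_toReal hint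

theorem isInverseLaplaceAt_laplace_mul_laplace [IsFiniteMeasure P] (hσm : AEMeasurable σ P)
    (hτm : AEMeasurable τ P) (hσ : ∀ᵐ ω ∂P, σ ω ≠ ∞) (hτ : ∀ᵐ ω ∂P, τ ω ≠ ∞)
    (hind : IndepFun σ τ P) (hne : ∀ᵐ ω ∂P, σ ω ≠ τ ω) (hc : 0 < c)
    (hint : Integrable (fun ω => Real.exp (c * (σ ω).toReal)) P) :
    IsInverseLaplaceAt (fun s => 1 / s * laplace P σ (-s) * laplace P τ s) c 0
      (P.real {ω | τ ω < σ ω}) := by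
  have hne' : ∀ᵐ ω ∂P, (σ ω).toReal ≠ (τ ω).toReal := by
    filter_upwards [hσ, hτ, hne] with ω hσω hτω hω
    rwa [Ne, ENNReal.toReal_eq_toReal_iff' hσω hτω]
  have hlt : P.real {ω | τ ω < σ ω} = P.real {ω | (τ ω).toReal < (σ ω).toReal} := by
    refine measureReal_congr ?_
    filter_upwards [hσ, hτ] with ω hσω hτω
    exact propext (ENNReal.toReal_lt_toReal hτω hσω).symm
  simpa only [laplace_eq_complexMGF hσ, laplace_eq_complexMGF hτ, neg_neg, hlt] using
    isInverseLaplaceAt_prob_lt hσm.ennreal_toReal hτm.ennreal_toReal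
      (hind.comp ENNReal.measurable_toReal ENNReal.measurable_toReal) hne' hc hint
      (integrable_exp_neg_mul_toReal hτm hc.le)

theorem isInverseLaplaceAt_laplace_mul_sub [IsFiniteMeasure P] {τ' : Ω → ℝ≥0∞} {v w : ℝ}
    (hσm : AEMeasurable σ P) (hτm : AEMeasurable τ P) (hτm' : AEMeasurable τ' P)
    (hσ : ∀ᵐ ω ∂P, σ ω ≠ ∞) (hτ : ∀ᵐ ω ∂P, τ ω ≠ ∞) (hτ' : ∀ᵐ ω ∂P, τ' ω ≠ ∞) (hc : 0 < c)
    (hint : Integrable (fun ω => Real.exp (c * (σ ω).toReal)) P)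
    (h : IsInverseLaplaceAt (fun s => 1 / s * laplace P σ (-s) * laplace P τ s) c 0 v)
    (h' : IsInverseLaplaceAt (fun s => 1 / s * laplace P σ (-s) * laplace P τ' s) c 0 w) :
    IsInverseLaplaceAt (fun s => 1 / s * laplace P σ (-s) * (laplace P τ s - laplace P τ' s)) c 0
      (v - w) := by
  have hfactor : Continuous fun y : ℝ => 1 / (c + y * I) * laplace P σ (-(c + y * I)) :=
    (continuous_const.div (by fun_prop) (add_mul_I_ne_zero hc.ne')).mul
      (continuous_laplace_neg_add_mul_I hσm hσ hint)
  simpa only [mul_sub] using h.sub h'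
    (hfactor.mul (continuous_laplace_add_mul_I hτm hτ (integrable_exp_neg_mul_toReal hτm hc.le)))
    (hfactor.mul
      (continuous_laplace_add_mul_I hτm' hτ' (integrable_exp_neg_mul_toReal hτm' hc.le)))

end RandomTimes

section Exponential

lemma expMeasure_Ioi {r : ℝ} (hr : 0 < r) (a : ℝ) :
    expMeasure r (Set.Ioi a) = ENNReal.ofReal (Real.exp (-(r * max a 0))) := by
  have := isProbabilityMeasure_expMeasure hr
  have hcdf := cdf_expMeasure_eq hr a
  rw [cdf_eq_real] at hcdf
  rw [← ofReal_measureReal, ← Set.compl_Iic, probReal_compl_eq_one_sub measurableSet_Iic, hcdf]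
  split_ifs with ha
  · rw [max_eq_left ha, sub_sub_cancel]
  · simp [max_eq_right (not_le.1 ha).le]

lemma ae_expMeasure_pos {r : ℝ} (hr : 0 < r) : ∀ᵐ x ∂expMeasure r, 0 < x := by
  have := isProbabilityMeasure_expMeasure hr
  exact (mem_ae_iff_prob_eq_one measurableSet_Ioi).2 (by simp [expMeasure_Ioi hr])

lemma nullSingletonClass_expMeasure (r : ℝ) : NullSingletonClass (expMeasure r) :=
  ⟨fun _ => withDensity_absolutelyContinuous volume (exponentialPDF r) Real.volume_singleton⟩

lemma expMeasure_eq_withDensity (r : ℝ) :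
    expMeasure r = volume.withDensity (exponentialPDF r) := rfl

lemma measurable_exponentialPDF (r : ℝ) : Measurable (exponentialPDF r) :=
  (measurable_exponentialPDFReal r).ennreal_ofReal

lemma exponentialPDF_toReal_smul_cexp {r : ℝ} (hr : 0 < r) (s : ℂ) :
    (fun x : ℝ => (exponentialPDF r x).toReal • Complex.exp (s * x)) =
      (Set.Ici (0 : ℝ)).indicator fun x : ℝ => (r : ℂ) * Complex.exp ((s - r) * x) := by
  ext x
  by_cases hx : 0 ≤ x
  · rw [Set.indicator_of_mem (Set.mem_Ici.2 hx), exponentialPDF_of_nonneg hx,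
      ENNReal.toReal_ofReal (by positivity), Complex.real_smul]
    push_cast
    rw [mul_assoc, ← Complex.exp_add]
    ring_nf
  · rw [Set.indicator_of_notMem (by simpa using hx), exponentialPDF_of_neg (not_le.1 hx)]
    simp

lemma integrable_exp_mul_expMeasure {r t : ℝ} (hr : 0 < r) (ht : t < r) :
    Integrable (fun x => Real.exp (t * x)) (expMeasure r) := by
  have hcexp : Integrable (fun x : ℝ => Complex.exp (t * x)) (expMeasure r) := by
    rw [expMeasure_eq_withDensity, integrable_withDensity_iff_integrable_smul'
      (measurable_exponentialPDF r) (ae_of_all _ fun _ => ENNReal.ofReal_lt_top),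
      exponentialPDF_toReal_smul_cexp hr, integrable_indicator_iff measurableSet_Ici,
      integrableOn_Ici_iff_integrableOn_Ioi]
    exact (integrableOn_exp_mul_complex_Ioi (by simpa using ht) 0).const_mul _
  simpa [Complex.norm_exp] using hcexp.norm

lemma complexMGF_id_expMeasure {r : ℝ} {s : ℂ} (hr : 0 < r) (hs : s.re < r) :
    complexMGF id (expMeasure r) s = r / (r - s) := by
  simp only [complexMGF, id]
  rw [expMeasure_eq_withDensity, integral_withDensity_eq_integral_toReal_smul
    (measurable_exponentialPDF r) (ae_of_all _ fun _ => ENNReal.ofReal_lt_top),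
    exponentialPDF_toReal_smul_cexp hr, integral_indicator measurableSet_Ici,
    integral_Ici_eq_integral_Ioi, integral_const_mul,
    integral_exp_mul_complex_Ioi (by simpa using hs), ← neg_sub, neg_div_neg_eq]
  simp [div_eq_mul_inv]

variable {Ω : Type*} [MeasurableSpace Ω] {P : Measure Ω} {X : Ω → ℝ} {r : ℝ}

lemma integrable_exp_mul_of_hasLaw_expMeasure {t : ℝ} (hX : HasLaw X (expMeasure r) P) (hr : 0 < r)
    (ht : t < r) : Integrable (fun ω => Real.exp (t * X ω)) P := by
  have hlaw := integrable_exp_mul_expMeasure hr ht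
  rw [← hX.map_eq] at hlaw
  exact hlaw.comp_aemeasurable hX.aemeasurable

lemma complexMGF_of_hasLaw_expMeasure {s : ℂ} (hX : HasLaw X (expMeasure r) P) (hr : 0 < r)
    (hs : s.re < r) : complexMGF X P s = r / (r - s) := by
  rw [← complexMGF_id_map hX.aemeasurable, hX.map_eq, complexMGF_id_expMeasure hr hs]

end Exponential

section Independence

lemma eq_pi_of_forall_Ioi {ι : Type*} [Fintype ι] {ν : ι → Measure ℝ}
    [∀ i, IsFiniteMeasure (ν i)] {ρ : Measure (ι → ℝ)}
    (h : ∀ a : ι → ℝ, ρ (Set.univ.pi fun i => Set.Ioi (a i)) = ∏ i, ν i (Set.Ioi (a i))) :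
    ρ = Measure.pi ν := by
  refine (Measure.pi_eq_generateFrom (C := fun _ => Set.range Set.Ioi)
    (fun _ => ((BorelSpace.measurable_eq (α := ℝ)).trans (borel_eq_generateFrom_Ioi ℝ)).symm)
    (fun _ => ?_) (fun i => ⟨fun n => Set.Ioi (-n : ℝ), fun n => ⟨_, rfl⟩,
      fun _ => measure_lt_top _ _, ?_⟩) fun s hs => ?_).symm
  · rintro _ ⟨a, rfl⟩ _ ⟨b, rfl⟩ _
    exact ⟨a ⊔ b, Set.Ioi_inter_Ioi.symm⟩
  · refine Set.eq_univ_of_forall fun x => ?_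
    obtain ⟨n, hn⟩ := exists_nat_gt (-x)
    exact Set.mem_iUnion.2 ⟨n, neg_lt.1 hn⟩
  · choose a ha using hs
    obtain rfl : (fun i => Set.Ioi (a i)) = s := funext ha
    exact h a

variable {Ω : Type*} [MeasurableSpace Ω] {P : Measure Ω} [IsProbabilityMeasure P] {X Y : Ω → ℝ}

lemma hasLaw_and_iIndepFun_of_measure_forall_lt {ι : Type*} [Fintype ι] {ν : ι → Measure ℝ}
    [∀ i, IsProbabilityMeasure (ν i)] {X : ι → Ω → ℝ} (hX : ∀ i, Measurable (X i))
    (h : ∀ a : ι → ℝ, P {ω | ∀ i, a i < X i ω} = ∏ i, ν i (Set.Ioi (a i))) :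
    (∀ i, HasLaw (X i) (ν i) P) ∧ iIndepFun X P := by
  have hjoint : HasLaw (fun ω i => X i ω) (Measure.pi ν) P := by
    refine ⟨by fun_prop, eq_pi_of_forall_Ioi fun a => ?_⟩
    rw [Measure.map_apply (by fun_prop) (.univ_pi fun _ => measurableSet_Ioi), ← h]
    congr with ω
    simp
  have hlaw : ∀ i, HasLaw (X i) (ν i) P := fun i =>
    (measurePreserving_eval ν i).fun_comp_hasLaw hjoint
  exact ⟨hlaw, (iIndepFun_iff_hasLaw_pi_pi hlaw).2 hjoint⟩

lemma ae_ne_of_indepFun (hX : AEMeasurable X P) (hY : AEMeasurable Y P) (hXY : IndepFun X Y P)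
    [NullSingletonClass (P.map X)] : ∀ᵐ ω ∂P, X ω ≠ Y ω := by
  have := Measure.isProbabilityMeasure_map hX
  have := Measure.isProbabilityMeasure_map hY
  have hdiag : MeasurableSet {p : ℝ × ℝ | p.1 = p.2} :=
    measurableSet_eq_fun (by fun_prop) (by fun_prop)
  have hnull : ∀ᵐ p ∂(P.map fun ω => (X ω, Y ω)), p.1 ≠ p.2 := by
    rw [(indepFun_iff_map_prod_eq_prod_map_map hX hY).1 hXY, ae_iff]
    simp [Measure.prod_apply_symm hdiag]
  exact (ae_map_iff (hX.prodMk hY) hdiag.compl).1 hnull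

lemma nullSingletonClass_map_add_of_indepFun (hX : AEMeasurable X P) (hY : AEMeasurable Y P)
    (hXY : IndepFun X Y P) [NullSingletonClass (P.map X)] : NullSingletonClass (P.map (X + Y)) := by
  refine ⟨fun x => ?_⟩
  rw [Measure.map_apply_of_aemeasurable (hX.add hY) (measurableSet_singleton x)]
  have hne := ae_ne_of_indepFun hX (hY.const_sub x)
    (hXY.comp measurable_id (measurable_id.const_sub x))
  exact measure_mono_null (fun ω (hω : X ω + Y ω = x) => not_not.2 (eq_sub_of_add_eq hω))
    (ae_iff.1 hne)

lemma nullSingletonClass_map_sum_of_iIndepFun {ι : Type*} {X : ι → Ω → ℝ}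
    (hX : ∀ i, AEMeasurable (X i) P) (hind : iIndepFun X P) {F : Finset ι} {i : ι} (hi : i ∈ F)
    [NullSingletonClass (P.map (X i))] : NullSingletonClass (P.map (∑ j ∈ F, X j)) := by
  classical
  rw [← Finset.add_sum_erase F X hi]
  exact nullSingletonClass_map_add_of_indepFun (hX i) (Finset.aemeasurable_sum _ fun j _ => hX j)
    (hind.indepFun_finsetSum_of_notMem₀ hX (Finset.notMem_erase i F)).symm

end Independence

section Paths

variable {Ω : Type*} {X : ℝ≥0 → Ω → ℕ} {ω : Ω}

/-- The first rational time at which the path `x` is in state `m`. Unlike `firstPassage`, which it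
agrees with on jump paths, it is a measurable function of the path. -/
noncomputable def rationalPassage (m : ℕ) (x : ℝ≥0 → ℕ) : ℝ≥0∞ :=
  ⨅ r : ℚ, if x (Real.toNNReal r) = m then (Real.toNNReal r : ℝ≥0∞) else ∞

lemma measurable_rationalPassage (m : ℕ) : Measurable (rationalPassage m) :=
  .iInf fun _ => .ite (measurableSet_eq_fun (measurable_pi_apply _) measurable_const)
    measurable_const measurable_const

/-- The path `x` visits the states `y 0, y 1, …` in this order and stays for a time `τ n` in the
`n`-th of them, without explosion. -/
def IsJumpPath (y : ℕ → ℕ) (τ : ℕ → ℝ≥0∞) (x : ℝ≥0 → ℕ) : Prop :=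
  ∀ t : ℝ≥0, ∃ n : ℕ, (∑ k ∈ Finset.range n, τ k) ≤ t ∧
    (t : ℝ≥0∞) < ∑ k ∈ Finset.range (n + 1), τ k ∧ x t = y n

variable {y : ℕ → ℕ} {τ : ℕ → ℝ≥0∞}

lemma monotone_sum_range (τ : ℕ → ℝ≥0∞) : Monotone fun n => ∑ k ∈ Finset.range n, τ k :=
  fun _ _ h => Finset.sum_le_sum_of_subset (Finset.range_mono h)

lemma IsJumpPath.eq_of_mem {x : ℝ≥0 → ℕ} (h : IsJumpPath y τ x) {n : ℕ} {t : ℝ≥0}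
    (hn : ∑ k ∈ Finset.range n, τ k ≤ t) (hn' : (t : ℝ≥0∞) < ∑ k ∈ Finset.range (n + 1), τ k) :
    x t = y n := by
  obtain ⟨j, hj, hj', hx⟩ := h t
  have hnj : n < j + 1 := (monotone_sum_range τ).reflect_lt (hn.trans_lt hj')
  have hjn : j < n + 1 := (monotone_sum_range τ).reflect_lt (hj.trans_lt hn')
  rw [hx, show j = n by omega]

lemma IsJumpPath.firstPassage_eq_rationalPassage (h : IsJumpPath y τ (X · ω)) (m : ℕ) :
    firstPassage X m ω = rationalPassage m (X · ω) := by
  apply le_antisymm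
  · refine le_iInf fun r => ?_
    split_ifs with hr
    · exact iInf_le_of_le _ (iInf_le _ hr)
    · exact le_top
  · refine le_iInf₂ fun t ht => le_of_forall_gt fun u hu => ?_
    obtain ⟨n, hn, hn', hx⟩ := h t
    obtain ⟨r, -, htr, hr⟩ := ENNReal.lt_iff_exists_rat_btwn.1 (lt_min hu hn')
    have hXr : X (Real.toNNReal r) ω = m :=
      (h.eq_of_mem (hn.trans htr.le) (hr.trans_le (min_le_right _ _))).trans (hx.symm.trans ht)
    calc rationalPassage m (X · ω) ≤ Real.toNNReal r := (iInf_le _ r).trans_eq (if_pos hXr)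
      _ < u := hr.trans_le (min_le_left _ _)

lemma IsJumpPath.firstPassage_pos (h : IsJumpPath y τ (X · ω)) {m : ℕ} (hy : y 0 ≠ m)
    (hτ : 0 < τ 0) : 0 < firstPassage X m ω := by
  refine hτ.trans_le (le_iInf₂ fun t ht => not_lt.1 fun hlt => hy ?_)
  exact (h.eq_of_mem (n := 0) (by simp) (by simpa using hlt)).symm.trans ht

lemma IsJumpPath.le_iff {q : ℕ} {x : ℝ≥0 → ℕ} (h : IsJumpPath (q - ·) τ x) (m : ℕ) (t : ℝ≥0) :
    x t ≤ m ↔ ∑ k ∈ Finset.range (q - m), τ k ≤ t := by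
  obtain ⟨n, hn, hn', hx⟩ := h t
  have hmono := monotone_sum_range τ
  rw [hx]
  refine ⟨fun hle => (hmono (by lia)).trans hn, fun hle => ?_⟩
  have hlt : q - m < n + 1 := hmono.reflect_lt (hle.trans_lt hn')
  lia

end Paths

section JumpChains

variable {Ω : Type*}

/-- The event that the chain `Y` starts with `y 0, …, y n` and that its `k`-th holding time `T k`
exceeds `t k` for `k < n`. -/
def cylinder (Y : ℕ → Ω → ℕ) (T : ℕ → Ω → ℝ≥0∞) (n : ℕ) (y : ℕ → ℕ) (t : ℕ → ℝ≥0) : Set Ω :=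
  {ω | (∀ k ≤ n, Y k ω = y k) ∧ ∀ k < n, (t k : ℝ≥0∞) < T k ω}

variable [MeasurableSpace Ω] {P : Measure Ω} {b d : ℕ → ℝ} {x₀ : ℕ} {X : ℝ≥0 → Ω → ℕ}
  {Y : ℕ → Ω → ℕ} {T : ℕ → Ω → ℝ≥0∞}

/-- `Y` and `T` are the embedded jump chain and the holding times in the description `IsBirthDeath`
of the birth-death process `X`. -/
structure IsJumpChain (P : Measure Ω) (b d : ℕ → ℝ) (x₀ : ℕ) (X : ℝ≥0 → Ω → ℕ) (Y : ℕ → Ω → ℕ)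
    (T : ℕ → Ω → ℝ≥0∞) : Prop where
  measurable_state : ∀ n, Measurable (Y n)
  measurable_holding : ∀ n, Measurable (T n)
  measure_cylinder : ∀ (n : ℕ) (y : ℕ → ℕ) (t : ℕ → ℝ≥0), P (cylinder Y T n y t) =
    if y 0 = x₀ then
      ENNReal.ofReal (∏ k ∈ Finset.range n,
        jumpProb b d (y k) (y (k + 1)) * Real.exp (-(totalRate b d (y k) * t k)))
    else 0
  isJumpPath : ∀ᵐ ω ∂P, IsJumpPath (Y · ω) (T · ω) (X · ω)

lemma IsBirthDeath.exists_isJumpChain (h : IsBirthDeath P b d x₀ X) :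
    ∃ Y T, IsJumpChain P b d x₀ X Y T :=
  let ⟨_, Y, T, hY, hT, hlaw, hpath⟩ := h
  ⟨Y, T, hY, hT, hlaw, hpath⟩

lemma IsBirthDeath.firstPassage_ae_eq (h : IsBirthDeath P b d x₀ X) (m : ℕ) :
    firstPassage X m =ᵐ[P] fun ω => rationalPassage m (X · ω) := by
  obtain ⟨Y, T, hchain⟩ := h.exists_isJumpChain
  filter_upwards [hchain.isJumpPath] with ω hpath using hpath.firstPassage_eq_rationalPassage m

lemma IsBirthDeath.aemeasurable_firstPassage (h : IsBirthDeath P b d x₀ X) (m : ℕ) :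
    AEMeasurable (firstPassage X m) P :=
  ⟨_, (measurable_rationalPassage m).comp (measurable_pi_lambda _ h.1), h.firstPassage_ae_eq m⟩

lemma IsBirthDeath.indepFun_firstPassage {β : Type*} [MeasurableSpace β] {Z : Ω → β}
    (h : IsBirthDeath P b d x₀ X) (hind : IndepFun (fun ω t => X t ω) Z P) (m : ℕ) :
    IndepFun (firstPassage X m) Z P :=
  (hind.comp (measurable_rationalPassage m) measurable_id).congr (h.firstPassage_ae_eq m).symm .rfl

lemma IsJumpChain.measurableSet_cylinder (h : IsJumpChain P b d x₀ X Y T) (n : ℕ) (y : ℕ → ℕ)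
    (t : ℕ → ℝ≥0) : MeasurableSet (cylinder Y T n y t) := by
  simp only [cylinder, Set.ofPred_and, Set.ofPred_forall]
  exact .inter
    (.iInter fun k => .iInter fun _ => h.measurable_state k (measurableSet_singleton _))
    (.iInter fun k => .iInter fun _ => measurableSet_lt measurable_const (h.measurable_holding k))

lemma sum_jumpProb (b d : ℕ → ℝ) (x : ℕ) :
    ∑ j ∈ Finset.range (x + 2), jumpProb b d x j = 1 := by
  by_cases h0 : totalRate b d x = 0
  · simp [jumpProb, h0]
  cases x with
  | zero =>
    have hb : b 0 ≠ 0 := by simpa [totalRate] using h0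
    simp [jumpProb, totalRate, hb]
  | succ k =>
    have hzero : ∑ j ∈ Finset.range k, jumpProb b d (k + 1) j = 0 :=
      Finset.sum_eq_zero fun j hj => by
        have := Finset.mem_range.1 hj
        simp [jumpProb, h0, show j ≠ k + 1 + 1 by lia, show j ≠ k by lia]
    simp only [Finset.sum_range_succ, hzero]
    simp only [jumpProb, h0, if_false, show k ≠ k + 1 + 1 by lia, if_true, Nat.succ_ne_self]
    rw [← div_self h0]
    simp [totalRate]
    ring

lemma IsJumpChain.ae_start [IsProbabilityMeasure P] (h : IsJumpChain P b d x₀ X Y T) :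
    ∀ᵐ ω ∂P, Y 0 ω = x₀ ∧ 0 < T 0 ω := by
  let A : ℕ → Set Ω := fun j => cylinder Y T 1 (fun k => if k = 0 then x₀ else j) 0
  have hA : ∀ j, MeasurableSet (A j) := fun j => h.measurableSet_cylinder _ _ _
  have hdisj : (Finset.range (x₀ + 2) : Set ℕ).PairwiseDisjoint A := fun i _ j _ hij =>
    Set.disjoint_left.2 fun ω hi hj => hij ((hi.1 1 le_rfl).symm.trans (hj.1 1 le_rfl))
  have hone : P (⋃ j ∈ Finset.range (x₀ + 2), A j) = 1 := by
    refine le_antisymm prob_le_one ?_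
    calc (1 : ℝ≥0∞) = ENNReal.ofReal (∑ j ∈ Finset.range (x₀ + 2), jumpProb b d x₀ j) := by
          rw [sum_jumpProb, ENNReal.ofReal_one]
      _ ≤ ∑ j ∈ Finset.range (x₀ + 2), ENNReal.ofReal (jumpProb b d x₀ j) :=
          Finset.le_sum_of_subadditive _ ENNReal.ofReal_zero.le
            (fun _ _ => ENNReal.ofReal_add_le) _ _
      _ = ∑ j ∈ Finset.range (x₀ + 2), P (A j) := by simp [A, h.measure_cylinder]
      _ = P (⋃ j ∈ Finset.range (x₀ + 2), A j) :=
          (measure_biUnion_finset hdisj fun j _ => hA j).symm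
  filter_upwards [(mem_ae_iff_prob_eq_one (Finset.measurableSet_biUnion _ fun j _ => hA j)).2 hone]
    with ω hω
  obtain ⟨j, -, hstate, hholding⟩ := Set.mem_iUnion₂.1 hω
  exact ⟨hstate 0 zero_le_one, hholding 0 one_pos⟩

lemma IsBirthDeath.firstPassage_pos [IsProbabilityMeasure P] (h : IsBirthDeath P b d x₀ X) {m : ℕ}
    (hm : x₀ ≠ m) : ∀ᵐ ω ∂P, 0 < firstPassage X m ω := by
  obtain ⟨Y, T, hchain⟩ := h.exists_isJumpChain
  filter_upwards [hchain.ae_start, hchain.isJumpPath] with ω hstart hpath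
  exact hpath.firstPassage_pos (hstart.1.trans_ne hm) hstart.2

end JumpChains

section PureDeath

variable {Ω : Type*} [MeasurableSpace Ω] {P : Measure Ω} {d : ℕ → ℝ} {q : ℕ} {X : ℝ≥0 → Ω → ℕ}
  {Y : ℕ → Ω → ℕ} {T : ℕ → Ω → ℝ≥0∞}

lemma jumpProb_pureDeath {x : ℕ} (hx : x ≠ 0 → d x ≠ 0) :
    jumpProb (fun _ => 0) d x (x - 1) = 1 := by
  cases x with
  | zero => simp [jumpProb, totalRate]
  | succ k => simp [jumpProb, totalRate, hx, show k ≠ k + 1 + 1 by lia]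

namespace IsJumpChain

variable (h : IsJumpChain P (fun _ => 0) d q X Y T) (hd : ∀ k, 1 ≤ k → k ≤ q → 0 < d k)

include h hd

lemma measure_cylinder_pureDeath (n : ℕ) (t : ℕ → ℝ≥0) : P (cylinder Y T n (q - ·) t) =
    ENNReal.ofReal (∏ k ∈ Finset.range n,
      Real.exp (-(totalRate (fun _ => 0) d (q - k) * t k))) := by
  have hjump : ∀ k, jumpProb (fun _ => 0) d (q - k) (q - (k + 1)) = 1 := fun k =>
    Nat.sub_sub q k 1 ▸ jumpProb_pureDeath fun h0 => (hd _ (by lia) (Nat.sub_le q k)).ne'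
  simp [h.measure_cylinder, hjump]

variable [IsProbabilityMeasure P]

lemma ae_state_eq_and_holding_pos : ∀ᵐ ω ∂P, ∀ n, Y n ω = q - n ∧ 0 < T n ω := by
  refine ae_all_iff.2 fun n => ?_
  have hone : P (cylinder Y T (n + 1) (q - ·) 0) = 1 := by
    simp [h.measure_cylinder_pureDeath hd]
  filter_upwards [(mem_ae_iff_prob_eq_one (h.measurableSet_cylinder _ _ _)).2 hone] with ω hω
  exact ⟨hω.1 n n.le_succ, hω.2 n n.lt_succ_self⟩

lemma measure_forall_lt_holding (t : ℕ → ℝ≥0) : P {ω | ∀ k < q, (t k : ℝ≥0∞) < T k ω} =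
    ∏ k ∈ Finset.range q, ENNReal.ofReal (Real.exp (-(d (q - k) * t k))) := by
  have hcyl : {ω | ∀ k < q, (t k : ℝ≥0∞) < T k ω} =ᵐ[P] cylinder Y T q (q - ·) t := by
    filter_upwards [h.ae_state_eq_and_holding_pos hd] with ω hω
    exact propext ⟨fun ht => ⟨fun k _ => (hω k).1, ht⟩, And.right⟩
  rw [measure_congr hcyl, h.measure_cylinder_pureDeath hd,
    ENNReal.ofReal_prod_of_nonneg fun _ _ => (Real.exp_pos _).le]
  refine Finset.prod_congr rfl fun k hk => ?_
  have hk0 : q - k ≠ 0 := Nat.sub_ne_zero_of_lt (Finset.mem_range.1 hk)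
  simp [totalRate, hk0]

lemma ae_holding_ne_top : ∀ᵐ ω ∂P, ∀ k < q, T k ω ≠ ∞ := by
  refine ae_all_iff.2 fun k => ?_
  by_cases hk : k < q
  swap
  · exact ae_of_all _ fun ω hkq => absurd hkq hk
  have hle : ∀ t : ℝ≥0, P {ω | T k ω = ∞} ≤ ENNReal.ofReal (Real.exp (-(d (q - k) * t))) := by
    intro t
    have htail := h.measure_forall_lt_holding hd (Pi.single k t)
    rw [Finset.prod_eq_single_of_mem k (Finset.mem_range.2 hk)
      fun j _ hj => by simp [Pi.single_eq_of_ne hj], Pi.single_eq_same] at htail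
    rw [← htail]
    refine measure_mono_ae ?_
    filter_upwards [h.ae_state_eq_and_holding_pos hd] with ω hω (hk' : T k ω = ∞) j _
    rcases eq_or_ne j k with rfl | hj
    · simp [hk']
    · simpa [Pi.single_eq_of_ne hj] using (hω j).2
  have hlim : Tendsto (fun t : ℝ≥0 => ENNReal.ofReal (Real.exp (-(d (q - k) * t)))) atTop
      (𝓝 0) := by
    rw [← ENNReal.ofReal_zero]
    refine ENNReal.tendsto_ofReal (Real.tendsto_exp_neg_atTop_nhds_zero.comp ?_)
    exact (NNReal.tendsto_coe_atTop.2 tendsto_id).const_mul_atTop (hd _ (by lia) (by lia))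
  have hnull : P {ω | T k ω = ∞} = 0 := le_antisymm (ge_of_tendsto' hlim hle) zero_le
  simpa [ae_iff, hk] using hnull

lemma ae_le_iff_sum_holding_le : ∀ᵐ ω ∂P, ∀ (m : ℕ) (t : ℝ≥0),
    X t ω ≤ m ↔ ∑ k ∈ Finset.range (q - m), T k ω ≤ t := by
  filter_upwards [h.ae_state_eq_and_holding_pos hd, h.isJumpPath] with ω hω hpath
  rw [show (Y · ω) = (q - ·) from funext fun n => (hω n).1] at hpath
  exact hpath.le_iff

end IsJumpChain

end PureDeath

section SojournTimes

variable {Ω : Type*} [MeasurableSpace Ω] {P : Measure Ω} {d : ℕ → ℝ} {q : ℕ} {X : ℝ≥0 → Ω → ℕ}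
  {Y : ℕ → Ω → ℕ} {T : ℕ → Ω → ℝ≥0∞} {S : Finset.Icc 1 q → Ω → ℝ}

/-- The states above `m`, among the states `1, …, q` of a pure-death process started at `q`. -/
def statesAbove (q m : ℕ) : Finset (Finset.Icc 1 q) :=
  {k | m < k}

/-- `S k` is the time that the pure-death process `X`, started at `q`, spends in state `k`, for
`1 ≤ k ≤ q`. These times are indexed by the state, not by the order of the visits, and real-valued:
on the null set where one of them is infinite, the value of `S` is irrelevant. -/
structure IsSojournTimes (P : Measure Ω) (d : ℕ → ℝ) (q : ℕ) (X : ℝ≥0 → Ω → ℕ)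
    (S : Finset.Icc 1 q → Ω → ℝ) : Prop where
  rate_pos : ∀ k : Finset.Icc 1 q, 0 < d k
  measurable : ∀ k, Measurable (S k)
  hasLaw : ∀ k, HasLaw (S k) (expMeasure (d k)) P
  iIndepFun : iIndepFun S P
  le_iff : ∀ᵐ ω ∂P, ∀ (m : ℕ) (t : ℝ≥0), X t ω ≤ m ↔ ∑ k ∈ statesAbove q m, S k ω ≤ t

@[to_additive]
lemma prod_statesAbove {M : Type*} [CommMonoid M] (q m : ℕ) (g : ℕ → M) :
    ∏ k ∈ statesAbove q m, g k = ∏ k ∈ Finset.Icc (m + 1) q, g k := by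
  rw [statesAbove, Finset.prod_filter,
    Finset.prod_coe_sort (Finset.Icc 1 q) fun k => if m < k then g k else 1, ← Finset.prod_filter]
  congr 1
  ext k
  simp only [Finset.mem_filter, Finset.mem_Icc]
  lia

@[to_additive]
lemma prod_range_sub {M : Type*} [CommMonoid M] (q m : ℕ) (g : ℕ → M) :
    ∏ k ∈ Finset.range (q - m), g (q - k) = ∏ k ∈ Finset.Icc (m + 1) q, g k := by
  refine Finset.prod_nbij' (q - ·) (q - ·) ?_ ?_ ?_ ?_ ?_ <;>
    simp only [Finset.mem_range, Finset.mem_Icc] <;> intros <;> first | rfl | lia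

lemma forall_lt_sub_iff_forall_Icc {p : ℕ → Prop} :
    (∀ k < q, p (q - k)) ↔ ∀ k : Finset.Icc 1 q, p k := by
  refine ⟨fun h k => ?_, fun h k hk => h ⟨q - k, Finset.mem_Icc.2 (by lia)⟩⟩
  obtain ⟨hk1, hkq⟩ := Finset.mem_Icc.1 k.2
  simpa [Nat.sub_sub_self hkq] using h (q - k) (by lia)

lemma coe_toNNReal_lt_iff_lt_toReal {a : ℝ} {x : ℝ≥0∞} (hx : 0 < x) (hx' : x ≠ ∞) :
    (a.toNNReal : ℝ≥0∞) < x ↔ a < x.toReal := by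
  rw [← ENNReal.ofReal_lt_ofReal_iff (ENNReal.toReal_pos hx.ne' hx'), ENNReal.ofReal_toReal hx',
    ENNReal.ofReal]

namespace IsJumpChain

variable [IsProbabilityMeasure P] (h : IsJumpChain P (fun _ => 0) d q X Y T)
  (hd : ∀ k, 1 ≤ k → k ≤ q → 0 < d k)

include h hd

lemma measure_forall_lt_toReal_holding (a : Finset.Icc 1 q → ℝ) :
    P {ω | ∀ k : Finset.Icc 1 q, a k < (T (q - k) ω).toReal} =
      ∏ k : Finset.Icc 1 q, expMeasure (d k) (Set.Ioi (a k)) := by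
  obtain ⟨b, rfl⟩ : ∃ b : ℕ → ℝ, a = fun k : Finset.Icc 1 q => b k :=
    ⟨Function.extend Subtype.val a 0,
      funext fun k => (Subtype.val_injective.extend_apply a 0 k).symm⟩
  have hev : {ω | ∀ k : Finset.Icc 1 q, b k < (T (q - k) ω).toReal} =ᵐ[P]
      {ω | ∀ k < q, ((b (q - k)).toNNReal : ℝ≥0∞) < T k ω} := by
    filter_upwards [h.ae_state_eq_and_holding_pos hd, h.ae_holding_ne_top hd] with ω hω hfin
    refine propext <| forall_lt_sub_iff_forall_Icc (p := fun k => b k < (T (q - k) ω).toReal)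
      |>.symm.trans (forall₂_congr fun k hk => ?_)
    rw [Nat.sub_sub_self hk.le, coe_toNNReal_lt_iff_lt_toReal (hω k).2 (hfin k hk)]
  rw [measure_congr hev, h.measure_forall_lt_holding hd]
  calc _ = ∏ k ∈ Finset.Icc 1 q, ENNReal.ofReal (Real.exp (-(d k * (b k).toNNReal))) :=
        prod_range_sub q 0 fun k => ENNReal.ofReal (Real.exp (-(d k * (b k).toNNReal)))
    _ = _ := by
      rw [← Finset.prod_coe_sort]
      refine Finset.prod_congr rfl fun k _ => ?_
      obtain ⟨hk1, hkq⟩ := Finset.mem_Icc.1 k.2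
      rw [expMeasure_Ioi (hd k hk1 hkq), Real.coe_toNNReal']

lemma isSojournTimes :
    IsSojournTimes P d q X fun (k : Finset.Icc 1 q) ω => (T (q - k) ω).toReal := by
  have hpos : ∀ k : Finset.Icc 1 q, 0 < d k := fun k =>
    hd k (Finset.mem_Icc.1 k.2).1 (Finset.mem_Icc.1 k.2).2
  have hprob : ∀ k : Finset.Icc 1 q, IsProbabilityMeasure (expMeasure (d k)) := fun k =>
    isProbabilityMeasure_expMeasure (hpos k)
  have hmeas : ∀ k : Finset.Icc 1 q, Measurable fun ω => (T (q - k) ω).toReal := fun k =>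
    (h.measurable_holding _).ennreal_toReal
  obtain ⟨hlaw, hind⟩ := hasLaw_and_iIndepFun_of_measure_forall_lt hmeas
    (h.measure_forall_lt_toReal_holding hd)
  refine ⟨hpos, hmeas, hlaw, hind, ?_⟩
  filter_upwards [h.ae_le_iff_sum_holding_le hd, h.ae_holding_ne_top hd] with ω hle hfin m t
  have hfin' : ∀ k ∈ Finset.range (q - m), T k ω ≠ ∞ := fun k hk =>
    hfin k (by have := Finset.mem_range.1 hk; lia)
  have hreal : ∑ k ∈ statesAbove q m, (T (q - k) ω).toReal =
      (∑ k ∈ Finset.range (q - m), T k ω).toReal := by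
    rw [sum_statesAbove q m fun k => (T (q - k) ω).toReal, ← sum_range_sub,
      ENNReal.toReal_sum hfin']
    refine Finset.sum_congr rfl fun k hk => ?_
    rw [Nat.sub_sub_self (by have := Finset.mem_range.1 hk; lia)]
  rw [hle, hreal, ← ENNReal.ofReal_coe_nnreal,
    ENNReal.le_ofReal_iff_toReal_le (ENNReal.sum_ne_top.2 hfin') t.coe_nonneg]

end IsJumpChain

lemma IsPureDeath.exists_isSojournTimes [IsProbabilityMeasure P] (h : IsPureDeath P d q X)
    (hd : ∀ k, 1 ≤ k → k ≤ q → 0 < d k) : ∃ S, IsSojournTimes P d q X S :=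
  let ⟨_, _, hchain⟩ := h.exists_isJumpChain
  ⟨_, hchain.isSojournTimes hd⟩

end SojournTimes

section PassageTimes

variable {Ω : Type*} [MeasurableSpace Ω] {P : Measure Ω} {d : ℕ → ℝ} {q m : ℕ} {X : ℝ≥0 → Ω → ℕ}
  {S : Finset.Icc 1 q → Ω → ℝ}

lemma statesAbove_self (q : ℕ) : statesAbove q q = ∅ :=
  Finset.filter_eq_empty_iff.2 fun k _ => (Finset.mem_Icc.1 k.2).2.not_gt

lemma statesAbove_subset {l : ℕ} (h : l ≤ m) : statesAbove q m ⊆ statesAbove q l :=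
  Finset.monotone_filter_right _ fun _ _ hk => h.trans_lt hk

lemma coe_mem_Icc_of_mem_statesAbove {k : Finset.Icc 1 q} (hk : k ∈ statesAbove q m) :
    (k : ℕ) ∈ Finset.Icc (m + 1) q :=
  Finset.mem_Icc.2 ⟨(Finset.mem_filter.1 hk).2, (Finset.mem_Icc.1 k.2).2⟩

namespace IsSojournTimes

variable (h : IsSojournTimes P d q X S)

include h

lemma ae_pos : ∀ᵐ ω ∂P, ∀ k, 0 < S k ω :=
  ae_all_iff.2 fun k => ((h.hasLaw k).ae_iff (p := (0 < ·)) (by fun_prop)).2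
    (ae_expMeasure_pos (h.rate_pos k))

lemma ae_firstPassage_eq : ∀ᵐ ω ∂P, ∀ m ≤ q,
    firstPassage X m ω = ENNReal.ofReal (∑ k ∈ statesAbove q m, S k ω) := by
  filter_upwards [h.ae_pos, h.le_iff] with ω hpos hle m hm
  have hnonneg : 0 ≤ ∑ k ∈ statesAbove q m, S k ω := Finset.sum_nonneg fun k _ => (hpos k).le
  apply le_antisymm
  · set t := (∑ k ∈ statesAbove q m, S k ω).toNNReal with ht
    have htm : X t ω ≤ m := (hle m t).2 (Real.coe_toNNReal _ hnonneg).ge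
    have hmt : m ≤ X t ω := by
      cases m with
      | zero => exact Nat.zero_le _
      | succ l =>
        refine not_lt.1 fun hlt => ((hle l t).1 (Nat.le_of_lt_succ hlt)).not_gt ?_
        rw [ht, Real.coe_toNNReal _ hnonneg]
        exact Finset.sum_lt_sum_of_subset (statesAbove_subset l.le_succ)
          (i := ⟨l + 1, Finset.mem_Icc.2 (by lia)⟩) (by simp [statesAbove]) (by simp [statesAbove])
          (hpos _) fun j _ _ => (hpos j).le
    exact iInf₂_le t (htm.antisymm hmt)
  · exact le_iInf₂ fun t ht => ENNReal.ofReal_le_coe.2 ((hle m t).1 ht.le)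

lemma ae_firstPassage_le_iff : ∀ᵐ ω ∂P, ∀ m ≤ q, ∀ t : ℝ≥0,
    firstPassage X m ω ≤ t ↔ X t ω ≤ m := by
  filter_upwards [h.le_iff, h.ae_firstPassage_eq] with ω hle hpass m hm t
  rw [hpass m hm, ENNReal.ofReal_le_coe, hle m t]

lemma ae_firstPassage_anti : ∀ᵐ ω ∂P, ∀ m ≤ q, ∀ l ≤ m,
    firstPassage X m ω ≤ firstPassage X l ω := by
  filter_upwards [h.ae_pos, h.ae_firstPassage_eq] with ω hpos hpass m hm l hl
  rw [hpass m hm, hpass l (hl.trans hm)]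
  exact ENNReal.ofReal_le_ofReal
    (Finset.sum_le_sum_of_subset_of_nonneg (statesAbove_subset hl) fun k _ _ => (hpos k).le)

lemma ae_firstPassage_start : ∀ᵐ ω ∂P, firstPassage X q ω = 0 := by
  filter_upwards [h.ae_firstPassage_eq] with ω hpass
  simp [hpass q le_rfl, statesAbove_self]

variable (hm : m ≤ q)

include hm

lemma aemeasurable_firstPassage : AEMeasurable (firstPassage X m) P :=
  ⟨_, (Finset.measurable_sum (statesAbove q m) fun k _ => h.measurable k).ennreal_ofReal,
    h.ae_firstPassage_eq.mono fun ω hpass => by simp [hpass m hm]⟩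

lemma ae_firstPassage_ne_top : ∀ᵐ ω ∂P, firstPassage X m ω ≠ ∞ := by
  filter_upwards [h.ae_firstPassage_eq] with ω hpass
  simp [hpass m hm]

lemma toReal_firstPassage_ae_eq :
    (fun ω => (firstPassage X m ω).toReal) =ᵐ[P] ∑ k ∈ statesAbove q m, S k := by
  filter_upwards [h.ae_pos, h.ae_firstPassage_eq] with ω hpos hpass
  rw [hpass m hm, ENNReal.toReal_ofReal (Finset.sum_nonneg fun k _ => (hpos k).le),
    Finset.sum_apply]

lemma integrable_exp_mul_firstPassage {t : ℝ} (ht : ∀ k ∈ Finset.Icc (m + 1) q, t < d k) :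
    Integrable (fun ω => Real.exp (t * (firstPassage X m ω).toReal)) P := by
  have := h.iIndepFun.isProbabilityMeasure
  have hsum := h.iIndepFun.integrable_exp_mul_sum h.measurable (s := statesAbove q m) (t := t)
    fun k hk => integrable_exp_mul_of_hasLaw_expMeasure (h.hasLaw k) (h.rate_pos k)
      (ht k (coe_mem_Icc_of_mem_statesAbove hk))
  refine hsum.congr ?_
  filter_upwards [h.toReal_firstPassage_ae_eq hm] with ω hω
  rw [hω]

lemma integrable_cexp_neg_mul_firstPassage {s : ℂ}
    (hs : ∀ k ∈ Finset.Icc (m + 1) q, -d k < s.re) :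
    Integrable (fun ω => Complex.exp (-s * (firstPassage X m ω).toReal)) P :=
  integrable_cexp_mul (h.aemeasurable_firstPassage hm).ennreal_toReal
    (h.integrable_exp_mul_firstPassage hm fun k hk => neg_lt.1 (hs k hk))

lemma laplace_firstPassage {s : ℂ} (hs : ∀ k ∈ Finset.Icc (m + 1) q, -d k < s.re) :
    laplace P (firstPassage X m) s = ∏ k ∈ Finset.Icc (m + 1) q, (d k : ℂ) / (d k + s) := by
  calc laplace P (firstPassage X m) s
      = complexMGF (∑ k ∈ statesAbove q m, S k) P (-s) := by
        rw [laplace_eq_complexMGF (h.ae_firstPassage_ne_top hm)]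
        exact integral_congr_ae
          ((h.toReal_firstPassage_ae_eq hm).mono fun ω hω => by simp only [hω])
    _ = ∏ k ∈ statesAbove q m, complexMGF (S k) P (-s) :=
        complexMGF_sum_of_iIndepFun (fun k => (h.measurable k).aemeasurable) h.iIndepFun _ _
    _ = ∏ k ∈ statesAbove q m, (d k : ℂ) / (d k + s) := by
        refine Finset.prod_congr rfl fun k hk => ?_
        rw [complexMGF_of_hasLaw_expMeasure (h.hasLaw k) (h.rate_pos k)
          (neg_lt.1 (hs k (coe_mem_Icc_of_mem_statesAbove hk))), sub_neg_eq_add]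
    _ = ∏ k ∈ Finset.Icc (m + 1) q, (d k : ℂ) / (d k + s) :=
        prod_statesAbove q m fun k => (d k : ℂ) / (d k + s)

lemma ae_firstPassage_ne {σ : Ω → ℝ≥0∞} (hσm : AEMeasurable σ P) (hσpos : ∀ᵐ ω ∂P, 0 < σ ω)
    (hind : IndepFun σ (firstPassage X m) P) : ∀ᵐ ω ∂P, firstPassage X m ω ≠ σ ω := by
  have := h.iIndepFun.isProbabilityMeasure
  rcases hm.eq_or_lt with rfl | hmq
  · filter_upwards [h.ae_firstPassage_start, hσpos] with ω hstart hpos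
    exact hstart.trans_ne hpos.ne
  let i : Finset.Icc 1 q := ⟨q, Finset.mem_Icc.2 (by lia)⟩
  have : NullSingletonClass (P.map (S i)) := by
    rw [(h.hasLaw i).map_eq]
    exact nullSingletonClass_expMeasure _
  have : NullSingletonClass (P.map fun ω => (firstPassage X m ω).toReal) := by
    rw [Measure.map_congr (h.toReal_firstPassage_ae_eq hm)]
    exact nullSingletonClass_map_sum_of_iIndepFun (fun k => (h.measurable k).aemeasurable)
      h.iIndepFun (Finset.mem_filter.2 ⟨Finset.mem_univ i, hmq⟩)
  have hne := ae_ne_of_indepFun (h.aemeasurable_firstPassage hm).ennreal_toReal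
    hσm.ennreal_toReal (hind.symm.comp ENNReal.measurable_toReal ENNReal.measurable_toReal)
  exact hne.mono fun ω hω heq => hω (congrArg ENNReal.toReal heq)

end IsSojournTimes

end PassageTimes

section Remaining

variable {Ω : Type*} [MeasurableSpace Ω] {P : Measure Ω} {d : ℕ → ℝ} {q m : ℕ}
  {Q X : ℝ≥0 → Ω → ℕ} {S : Finset.Icc 1 q → Ω → ℝ}

lemma measureReal_le_eq_lt {σ τ : Ω → ℝ≥0∞} (hne : ∀ᵐ ω ∂P, τ ω ≠ σ ω) :
    P.real {ω | τ ω ≤ σ ω} = P.real {ω | τ ω < σ ω} := by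
  refine measureReal_congr ?_
  filter_upwards [hne] with ω hω
  exact propext hω.le_iff_lt

lemma measureReal_le_and_lt [IsFiniteMeasure P] {α β σ : Ω → ℝ≥0∞} (hβ : AEMeasurable β P)
    (hσ : AEMeasurable σ P) (hαβ : ∀ᵐ ω ∂P, α ω ≤ β ω) :
    P.real {ω | α ω ≤ σ ω ∧ σ ω < β ω} =
      P.real {ω | α ω ≤ σ ω} - P.real {ω | β ω ≤ σ ω} := by
  have hinter : ({ω | α ω ≤ σ ω} ∩ {ω | β ω ≤ σ ω} : Set Ω) =ᵐ[P] {ω | β ω ≤ σ ω} := by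
    filter_upwards [hαβ] with ω hω
    exact propext ⟨And.right, fun hβσ => ⟨hω.trans hβσ, hβσ⟩⟩
  have hdiff : {ω | α ω ≤ σ ω ∧ σ ω < β ω} = {ω | α ω ≤ σ ω} \ {ω | β ω ≤ σ ω} := by
    ext ω
    exact and_congr_right fun _ => not_le.symm
  rw [hdiff, ← measureReal_congr hinter, eq_sub_iff_add_eq',
    measureReal_inter_add_sdiff₀ (nullMeasurableSet_le hβ hσ)]

namespace IsSojournTimes

section Events

variable (h : IsSojournTimes P d q X S) (hfin : ∀ᵐ ω ∂P, firstPassage Q 0 ω ≠ ∞)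

include h hfin

lemma remainingProb_eq (hm : 2 ≤ m) (hmq : m ≤ q) : remainingProb P Q X m =
    P.real {ω | firstPassage X m ω ≤ firstPassage Q 0 ω ∧
      firstPassage Q 0 ω < firstPassage X (m - 1) ω} := by
  refine measureReal_congr ?_
  filter_upwards [h.ae_firstPassage_le_iff, hfin] with ω hle hσ
  have hle_m := hle m hmq (firstPassage Q 0 ω).toNNReal
  have hle_pred := hle (m - 1) (by lia) (firstPassage Q 0 ω).toNNReal
  rw [ENNReal.coe_toNNReal hσ] at hle_m hle_pred
  refine propext (?_ : _ ∧ max _ 1 = m ↔ _ ∧ _)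
  rw [hle_m, ← not_le, hle_pred, quoteTime, and_iff_right hσ]
  lia

lemma remainingProb_one_eq (hq : 1 ≤ q) :
    remainingProb P Q X 1 = P.real {ω | firstPassage X 1 ω ≤ firstPassage Q 0 ω} := by
  refine measureReal_congr ?_
  filter_upwards [h.ae_firstPassage_le_iff, hfin] with ω hle hσ
  have hle_one := hle 1 hq (firstPassage Q 0 ω).toNNReal
  rw [ENNReal.coe_toNNReal hσ] at hle_one
  refine propext (?_ : _ ∧ max _ 1 = 1 ↔ firstPassage X 1 ω ≤ firstPassage Q 0 ω)
  rw [hle_one, quoteTime, and_iff_right hσ, max_eq_right_iff]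

lemma remainingProb_start (hq : 2 ≤ q) :
    remainingProb P Q X q = P.real {ω | firstPassage Q 0 ω < firstPassage X (q - 1) ω} := by
  rw [h.remainingProb_eq hfin hq le_rfl]
  refine measureReal_congr ?_
  filter_upwards [h.ae_firstPassage_start] with ω hstart
  exact propext (and_iff_right (hstart.trans_le zero_le))

end Events

variable (h : IsSojournTimes P d q X S) (hσm : AEMeasurable (firstPassage Q 0) P)
  (hσpos : ∀ᵐ ω ∂P, 0 < firstPassage Q 0 ω) (hfin : ∀ᵐ ω ∂P, firstPassage Q 0 ω ≠ ∞)
  (hind : ∀ m, IndepFun (firstPassage Q 0) (firstPassage X m) P)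

include h hσm hσpos hfin hind

lemma remainingProb_one (hq : 1 ≤ q) :
    remainingProb P Q X 1 = P.real {ω | firstPassage X 1 ω < firstPassage Q 0 ω} := by
  rw [h.remainingProb_one_eq hfin hq,
    measureReal_le_eq_lt (h.ae_firstPassage_ne hq hσm hσpos (hind 1))]

lemma remainingProb_of_lt (hm : 1 < m) (hmq : m < q) : remainingProb P Q X m =
    P.real {ω | firstPassage X m ω < firstPassage Q 0 ω} -
      P.real {ω | firstPassage X (m - 1) ω < firstPassage Q 0 ω} := by
  have := h.iIndepFun.isProbabilityMeasure
  have hmq' : m - 1 ≤ q := by lia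
  rw [h.remainingProb_eq hfin hm hmq.le,
    measureReal_le_and_lt (h.aemeasurable_firstPassage hmq') hσm
      (h.ae_firstPassage_anti.mono fun ω hanti => hanti m hmq.le _ (Nat.sub_le m 1)),
    measureReal_le_eq_lt (h.ae_firstPassage_ne hmq.le hσm hσpos (hind m)),
    measureReal_le_eq_lt (h.ae_firstPassage_ne hmq' hσm hσpos (hind (m - 1)))]

lemma isInverseLaplaceAt_prob_firstPassage_lt (hmq : m ≤ q) {c : ℝ} (hc : 0 < c)
    (hint : Integrable (fun ω => Real.exp (c * (firstPassage Q 0 ω).toReal)) P) :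
    IsInverseLaplaceAt (fun s => 1 / s * laplace P (firstPassage Q 0) (-s) *
      laplace P (firstPassage X m) s) c 0
      (P.real {ω | firstPassage X m ω < firstPassage Q 0 ω}) := by
  have := h.iIndepFun.isProbabilityMeasure
  exact isInverseLaplaceAt_laplace_mul_laplace hσm (h.aemeasurable_firstPassage hmq) hfin
    (h.ae_firstPassage_ne_top hmq) (hind m)
    ((h.ae_firstPassage_ne hmq hσm hσpos (hind m)).mono fun _ => Ne.symm) hc hint

lemma isInverseLaplaceAt_remainingProb_one (hq : 1 ≤ q) {c : ℝ} (hc : 0 < c)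
    (hint : Integrable (fun ω => Real.exp (c * (firstPassage Q 0 ω).toReal)) P) :
    IsInverseLaplaceAt (fun s => 1 / s * laplace P (firstPassage Q 0) (-s) *
      laplace P (firstPassage X 1) s) c 0 (remainingProb P Q X 1) :=
  h.remainingProb_one hσm hσpos hfin hind hq ▸
    h.isInverseLaplaceAt_prob_firstPassage_lt hσm hσpos hfin hind hq hc hint

lemma isInverseLaplaceAt_remainingProb_of_lt (hm : 1 < m) (hmq : m < q) {c : ℝ} (hc : 0 < c)
    (hint : Integrable (fun ω => Real.exp (c * (firstPassage Q 0 ω).toReal)) P) :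
    IsInverseLaplaceAt (fun s => 1 / s * laplace P (firstPassage Q 0) (-s) *
      (laplace P (firstPassage X m) s - laplace P (firstPassage X (m - 1)) s)) c 0
      (remainingProb P Q X m) := by
  have := h.iIndepFun.isProbabilityMeasure
  have hmq' : m - 1 ≤ q := by lia
  rw [h.remainingProb_of_lt hσm hσpos hfin hind hm hmq]
  exact isInverseLaplaceAt_laplace_mul_sub hσm (h.aemeasurable_firstPassage hmq.le)
    (h.aemeasurable_firstPassage hmq') hfin (h.ae_firstPassage_ne_top hmq.le)
    (h.ae_firstPassage_ne_top hmq') hc hint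
    (h.isInverseLaplaceAt_prob_firstPassage_lt hσm hσpos hfin hind hmq.le hc hint)
    (h.isInverseLaplaceAt_prob_firstPassage_lt hσm hσpos hfin hind hmq' hc hint)

lemma isInverseLaplaceAt_remainingProb_start (hq : 2 ≤ q) {c : ℝ} (hc : 0 < c) (hcq : c < d q) :
    IsInverseLaplaceAt (fun s => 1 / s * laplace P (firstPassage Q 0) s *
      laplace P (firstPassage X (q - 1)) (-s)) c 0 (remainingProb P Q X q) := by
  have := h.iIndepFun.isProbabilityMeasure
  have hpred : q - 1 ≤ q := Nat.sub_le q 1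
  have hint : Integrable (fun ω => Real.exp (c * (firstPassage X (q - 1) ω).toReal)) P :=
    h.integrable_exp_mul_firstPassage hpred fun k hk => by
      rwa [show k = q by have := Finset.mem_Icc.1 hk; lia]
  rw [h.remainingProb_start hfin hq]
  simpa only [mul_right_comm] using
    isInverseLaplaceAt_laplace_mul_laplace (h.aemeasurable_firstPassage hpred) hσm
      (h.ae_firstPassage_ne_top hpred) hfin (hind (q - 1)).symm
      (h.ae_firstPassage_ne hpred hσm hσpos (hind (q - 1))) hc hint

end IsSojournTimes

end Remaining

end LimitOrderBook

open LimitOrderBook in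
theorem mainTheorem6_general {Ω : Type*} [MeasurableSpace Ω] (P : Measure Ω)
    [IsProbabilityMeasure P] (q : ℕ) (hq : 1 ≤ q) (phiDeep : ℕ → ℝ)
    (hphiDeep : ∀ k, 1 ≤ k → k ≤ q → 0 < phiDeep k)
    (Q Wt : ℝ≥0 → Ω → ℕ) (hWt : IsPureDeath P phiDeep q Wt)
    (hσm : AEMeasurable (firstPassage Q 0) P) (hσpos : ∀ᵐ ω ∂P, 0 < firstPassage Q 0 ω)
    (hindep : IndepFun (firstPassage Q 0) (fun ω t => Wt t ω) P)
    (hfin : ∀ᵐ ω ∂P, firstPassage Q 0 ω ≠ ∞) :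
    (∀ m ≤ q, (∀ᵐ ω ∂P, firstPassage Wt m ω ≠ ∞) ∧
      ∀ s : ℂ, (∀ k ∈ Finset.Icc (m + 1) q, -phiDeep k < s.re) →
        Integrable (fun ω =>
          Complex.exp (-s * ((firstPassage Wt m ω).toReal : ℂ))) P ∧
        laplace P (firstPassage Wt m) s =
          ∏ k ∈ Finset.Icc (m + 1) q, (phiDeep k : ℂ) / ((phiDeep k : ℂ) + s)) ∧
    (2 ≤ q →
      remainingProb P Q Wt q =
        P.real {ω | firstPassage Q 0 ω <
          firstPassage Wt (q - 1) ω} ∧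
      ∀ c : ℝ, 0 < c → c < phiDeep q →
        IsInverseLaplaceAt
          (fun s => 1 / s * laplace P (firstPassage Q 0) s *
            laplace P (firstPassage Wt (q - 1)) (-s))
          c 0 (remainingProb P Q Wt q)) ∧
    (∀ m, 1 < m → m < q →
      remainingProb P Q Wt m =
        P.real {ω | firstPassage Wt m ω < firstPassage Q 0 ω} -
        P.real {ω | firstPassage Wt (m - 1) ω <
          firstPassage Q 0 ω} ∧
      ∀ c : ℝ, 0 < c →
        Integrable (fun ω => Real.exp (c * (firstPassage Q 0 ω).toReal)) P →
        IsInverseLaplaceAt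
          (fun s => 1 / s * laplace P (firstPassage Q 0) (-s) *
            (laplace P (firstPassage Wt m) s -
              laplace P (firstPassage Wt (m - 1)) s))
          c 0 (remainingProb P Q Wt m)) ∧
    (remainingProb P Q Wt 1 =
        P.real {ω | firstPassage Wt 1 ω < firstPassage Q 0 ω} ∧
      ∀ c : ℝ, 0 < c →
        Integrable (fun ω => Real.exp (c * (firstPassage Q 0 ω).toReal)) P →
        IsInverseLaplaceAt
          (fun s => 1 / s * laplace P (firstPassage Q 0) (-s) *
            laplace P (firstPassage Wt 1) s)
          c 0 (remainingProb P Q Wt 1)) := by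
  obtain ⟨S, hS⟩ := hWt.exists_isSojournTimes hphiDeep
  have hind : ∀ m, IndepFun (firstPassage Q 0) (firstPassage Wt m) P := fun m =>
    (hWt.indepFun_firstPassage hindep.symm m).symm
  refine ⟨fun m hm => ⟨hS.ae_firstPassage_ne_top hm, fun s hs => ⟨?_, ?_⟩⟩,
    fun hq2 => ⟨?_, fun c hc hcq => ?_⟩, fun m hm hmq => ⟨?_, fun c hc hint => ?_⟩,
    ?_, fun c hc hint => ?_⟩
  · exact hS.integrable_cexp_neg_mul_firstPassage hm hs
  · exact hS.laplace_firstPassage hm hs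
  · exact hS.remainingProb_start hfin hq2
  · exact hS.isInverseLaplaceAt_remainingProb_start hσm hσpos hfin hind hq2 hc hcq
  · exact hS.remainingProb_of_lt hσm hσpos hfin hind hm hmq
  · exact hS.isInverseLaplaceAt_remainingProb_of_lt hσm hσpos hfin hind hm hmq hc hint
  · exact hS.remainingProb_one hσm hσpos hfin hind hq
  · exact hS.isInverseLaplaceAt_remainingProb_one hσm hσpos hfin hind hq hc hint

theorem mainTheorem6 {Ω : Type*} [MeasurableSpace Ω] (P : Measure Ω) [IsProbabilityMeasure P]
    -- rates at the best quote: limit orders, market orders, cancellations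
    (lam mu phi : ℕ → ℝ)
    (hlam : ∀ k, 0 ≤ lam k) (hmu : ∀ k, 0 ≤ mu k) (hphi : ∀ k, 0 ≤ phi k)
    -- initial queue size at the best quote and at the deeper level
    (qBest q : ℕ) (hqBest : 1 ≤ qBest) (hq : 1 ≤ q)
    -- cancellation rates at the deeper level
    (phiDeep : ℕ → ℝ) (hphiDeep : ∀ k, 1 ≤ k → k ≤ q → 0 < phiDeep k)
    -- the best-quote queue, and the cancellation-only process at the deeper level
    (Q Wt : ℝ≥0 → Ω → ℕ)
    (hQ : LimitOrderBook.IsBirthDeath P lam (fun k => mu k + phi k) qBest Q)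
    (hWt : LimitOrderBook.IsPureDeath P phiDeep q Wt)
    (hindep : IndepFun (fun ω t => Q t ω) (fun ω t => Wt t ω) P)
    (hfin : ∀ᵐ ω ∂P, LimitOrderBook.firstPassage Q 0 ω ≠ ∞) :
    -- Laplace transform of the passage time from `q` to `m`
    (∀ m ≤ q, (∀ᵐ ω ∂P, LimitOrderBook.firstPassage Wt m ω ≠ ∞) ∧
      ∀ s : ℂ, (∀ k ∈ Finset.Icc (m + 1) q, -phiDeep k < s.re) →
        Integrable (fun ω =>
          Complex.exp (-s * ((LimitOrderBook.firstPassage Wt m ω).toReal : ℂ))) P ∧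
        LimitOrderBook.laplace P (LimitOrderBook.firstPassage Wt m) s =
          ∏ k ∈ Finset.Icc (m + 1) q, (phiDeep k : ℂ) / ((phiDeep k : ℂ) + s)) ∧
    -- `m = q`
    (2 ≤ q →
      LimitOrderBook.remainingProb P Q Wt q =
        P.real {ω | LimitOrderBook.firstPassage Q 0 ω <
          LimitOrderBook.firstPassage Wt (q - 1) ω} ∧
      ∀ c : ℝ, 0 < c → c < phiDeep q →
        LimitOrderBook.IsInverseLaplaceAt
          (fun s => 1 / s * LimitOrderBook.laplace P (LimitOrderBook.firstPassage Q 0) s *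
            LimitOrderBook.laplace P (LimitOrderBook.firstPassage Wt (q - 1)) (-s))
          c 0 (LimitOrderBook.remainingProb P Q Wt q)) ∧
    -- `1 < m < q`
    (∀ m, 1 < m → m < q →
      LimitOrderBook.remainingProb P Q Wt m =
        P.real {ω | LimitOrderBook.firstPassage Wt m ω < LimitOrderBook.firstPassage Q 0 ω} -
        P.real {ω | LimitOrderBook.firstPassage Wt (m - 1) ω <
          LimitOrderBook.firstPassage Q 0 ω} ∧
      ∀ c : ℝ, 0 < c →
        Integrable (fun ω => Real.exp (c * (LimitOrderBook.firstPassage Q 0 ω).toReal)) P →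
        LimitOrderBook.IsInverseLaplaceAt
          (fun s => 1 / s * LimitOrderBook.laplace P (LimitOrderBook.firstPassage Q 0) (-s) *
            (LimitOrderBook.laplace P (LimitOrderBook.firstPassage Wt m) s -
              LimitOrderBook.laplace P (LimitOrderBook.firstPassage Wt (m - 1)) s))
          c 0 (LimitOrderBook.remainingProb P Q Wt m)) ∧
    -- `m = 1`
    (LimitOrderBook.remainingProb P Q Wt 1 =
        P.real {ω | LimitOrderBook.firstPassage Wt 1 ω < LimitOrderBook.firstPassage Q 0 ω} ∧
      ∀ c : ℝ, 0 < c →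
        Integrable (fun ω => Real.exp (c * (LimitOrderBook.firstPassage Q 0 ω).toReal)) P →
        LimitOrderBook.IsInverseLaplaceAt
          (fun s => 1 / s * LimitOrderBook.laplace P (LimitOrderBook.firstPassage Q 0) (-s) *
            LimitOrderBook.laplace P (LimitOrderBook.firstPassage Wt 1) s)
          c 0 (LimitOrderBook.remainingProb P Q Wt 1)) :=
  mainTheorem6_general P q hq phiDeep hphiDeep Q Wt hWt
    (hQ.aemeasurable_firstPassage 0) (hQ.firstPassage_pos (by lia))
    (hQ.indepFun_firstPassage hindep 0) hfin
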